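/- Notation. $\mathbb R^{p\times r}$ carries the inner product $\langle x,y\rangle=\operatorname{Tr}(x^\top y)$ and the Frobenius norm. $\mathcal M\subset\mathbb R^{p\times r}$ is a compact smooth embedded submanifold with the induced metric; $\mathtt{grad}$ denotes the Riemannian gradient along $\mathcal M$ and $\nabla$ the Euclidean gradient; $\mathcal P_{\mathcal M}(s)\in\operatorname{argmin}_{y\in\mathcal M}\frac12\|s-y\|^2$ is the projection onto $\mathcal M$. The random variable $\xi\sim\mathcal D$ is the noise, $F(x,\xi)$ is a (measurable) stochastic function and $f(x)=\mathbb E_{\xi}[F(x,\xi)]$. Assumptions. Let $\gamma>0$, $\chi>0$, $l\ge 0$, $\sigma\ge 0$. 1. $\mathcal M$ is $2\gamma$-proximally smooth: every $s$ with $\mathrm{dist}(s,\mathcal M)<2\gamma$ has a unique nearest point in $\mathcal M$. 2. $\mathbb E_\xi[F(x,\xi)]=f(x)$ for all $x\in\mathbb R^{p\times r}$, and for all $x\in\mathcal M$, $\mathbb E_\xi[\mathtt{grad}F(x,\xi)]=\mathtt{grad}f(x)$ and $\mathbb E_\xi[\|\mathtt{grad}F(x,\xi)-\mathtt{grad}f(x)\|^2]\le\sigma^2$.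 3. Almost surely, $F(\cdot,\xi)$ is differentiable at every point of $\mathrm{conv}(\mathcal M)$, $\max_{x\in\mathcal M}\|\nabla F(x,\xi)\|\le\chi$, and $\|\nabla F(x,\xi)-\nabla F(y,\xi)\|\le l\|x-y\|$ for all $x,y\in\mathrm{conv}(\mathcal M)$. For $x\in\mathcal M$, $\mu>0$ and $m\ge1$ let $$G^{\mathtt P}_\mu(x)=\frac{pr}{m}\sum_{j=1}^m\frac{F(\mathcal P_{\mathcal M}(x+\mu u_j),\xi_j)-F(x,\xi_j)}{\mu}\,u_j,$$ where $u_1,\dots,u_m$ are uniformly distributed on the unit sphere of $\mathbb R^{p\times r}$, $\xi_1,\dots,\xi_m\sim\mathcal D$, and all these variables are independent. Lemma 3.4. For given $\gamma,\chi,l$ there exist constants $\chi_1=\chi_1(p,r)=\mathcal O(p^2r^2)$ and $\chi_2=\chi_2(p,r,\sigma)=\mathcal O(p^2r^2+\sigma^2)$, where the implied constants depend only on $\gamma,\chi,l$, such that under Assumptions 1–3, for every $x\in\mathcal M$, every $m\ge1$ and every $0<\mu\le\gamma$, the random variable $\|G^{\mathtt P}_\mu(x)-\mathtt{grad}f(x)\|^2$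 is integrable and $$\mathbb E\left[\left\|G^{\mathtt P}_\mu(x)-\mathtt{grad}f(x)\right\|^2\right]\le\chi_1\mu^2+\frac{\chi_2}{m},$$ the expectation being over $u_1,\dots,u_m$ and $\xi_1,\dots,\xi_m$. -/

import Mathlib

open MeasureTheory ProbabilityTheory Topology Set
open scoped ContDiff

noncomputable section

/-- The space of real `p × r` matrices, with the trace inner product `⟪x, y⟫ = ∑ i j, x i j * y i j`
and hence the Frobenius norm. -/
abbrev MatSpace (p r : ℕ) : Type := EuclideanSpace ℝ (Fin p × Fin r)

/-- `M` is a smooth embedded submanifold (of constant codimension `k`): locally it is the zero set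
of a smooth map to `ℝᵏ` whose derivative at the given point has full rank `k`. -/
def IsEmbeddedSubmanifold {p r : ℕ} (M : Set (MatSpace p r)) : Prop :=
  ∃ k : ℕ, ∀ x ∈ M, ∃ U : Set (MatSpace p r), IsOpen U ∧ x ∈ U ∧
    ∃ h : MatSpace p r → EuclideanSpace ℝ (Fin k), ContDiffOn ℝ ∞ h U ∧
      (∀ y ∈ U, y ∈ M ↔ h y = 0) ∧ Function.Surjective (fderiv ℝ h x)

/-- `c` restricts to a smooth curve in `M`, defined on an open interval around `0`,
with `c 0 = x`. -/
def IsSmoothCurveAt {p r : ℕ} (M : Set (MatSpace p r)) (x : MatSpace p r)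
    (c : ℝ → MatSpace p r) : Prop :=
  c 0 = x ∧ ∃ ε : ℝ, 0 < ε ∧ ContDiffOn ℝ ∞ c (Ioo (-ε) ε) ∧ ∀ t ∈ Ioo (-ε) ε, c t ∈ M

/-- The tangent space `T_x M`: the velocities at `x` of the smooth curves in `M` through `x`.
For an embedded submanifold the set of these velocities is already a linear subspace; the span
only packages it as one. -/
def tangentSpaceAt {p r : ℕ} (M : Set (MatSpace p r)) (x : MatSpace p r) :
    Submodule ℝ (MatSpace p r) :=
  Submodule.span ℝ {v | ∃ c : ℝ → MatSpace p r, IsSmoothCurveAt M x c ∧ deriv c 0 = v}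

/-- `g` is a Riemannian gradient at `x` of the restriction of `f` to `M`: it is tangent, and the
derivative of `f` at `x` along each tangent vector `s` (computed along the curves with velocity `s`)
is `⟪g, s⟫`. There is at most one such `g`. -/
def IsRiemannianGradient {p r : ℕ} (M : Set (MatSpace p r)) (f : MatSpace p r → ℝ)
    (x g : MatSpace p r) : Prop :=
  g ∈ tangentSpaceAt M x ∧ ∀ c : ℝ → MatSpace p r, IsSmoothCurveAt M x c →
    HasDerivAt (fun t => f (c t)) (inner ℝ g (deriv c 0)) 0

/-- The Riemannian gradient `grad f (x)` (unspecified if `f` has none at `x`). -/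
def riemannianGradient {p r : ℕ} (M : Set (MatSpace p r)) (f : MatSpace p r → ℝ)
    (x : MatSpace p r) : MatSpace p r :=
  Classical.epsilon (IsRiemannianGradient M f x)

/-- `z` is a nearest point of `M` to `s`, i.e. an element of `argmin_{y ∈ M} ½‖s - y‖²`. -/
def IsNearestPoint {p r : ℕ} (M : Set (MatSpace p r)) (s z : MatSpace p r) : Prop :=
  z ∈ M ∧ ∀ y ∈ M, (1 / 2 : ℝ) * ‖s - z‖ ^ 2 ≤ (1 / 2 : ℝ) * ‖s - y‖ ^ 2

/-- The projection operator: some element of the argmin. -/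
def projOnto {p r : ℕ} (M : Set (MatSpace p r)) (s : MatSpace p r) : MatSpace p r :=
  Classical.epsilon (IsNearestPoint M s)

/-- `M` is `R`-proximally smooth: each point at distance less than `R` from `M` has a unique
nearest point in `M`. -/
def IsProximallySmooth {p r : ℕ} (M : Set (MatSpace p r)) (R : ℝ) : Prop :=
  ∀ s : MatSpace p r, Metric.infDist s M < R → ∃! z, IsNearestPoint M s z

/-- The uniform distribution on the unit sphere of `MatSpace p r`, as a measure on `MatSpace p r`:
the normalized surface measure. -/
def uniformUnitSphere (p r : ℕ) : Measure (MatSpace p r) :=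
  (((volume : Measure (MatSpace p r)).toSphere univ)⁻¹ •
    (volume : Measure (MatSpace p r)).toSphere).map Subtype.val

/-- `F x ξ`, with `ξ` of law `D`, is a stochastic oracle for `f`: its values are unbiased, its
Riemannian gradients along `M` are unbiased, and the latter have variance at most `σ²`. -/
structure IsUnbiasedOracle {p r : ℕ} {Ξ : Type*} [MeasurableSpace Ξ] (M : Set (MatSpace p r))
    (D : Measure Ξ) (F : MatSpace p r → Ξ → ℝ) (f : MatSpace p r → ℝ) (σ : ℝ) : Prop where
  integrable : ∀ x, Integrable (F x) D
  unbiased : ∀ x, ∫ ξ, F x ξ ∂D = f x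
  integrable_grad : ∀ x ∈ M, Integrable (fun ξ => riemannianGradient M (fun y => F y ξ) x) D
  unbiased_grad : ∀ x ∈ M,
    ∫ ξ, riemannianGradient M (fun y => F y ξ) x ∂D = riemannianGradient M f x
  integrable_variance : ∀ x ∈ M, Integrable
    (fun ξ => ‖riemannianGradient M (fun y => F y ξ) x - riemannianGradient M f x‖ ^ 2) D
  variance_le : ∀ x ∈ M,
    ∫ ξ, ‖riemannianGradient M (fun y => F y ξ) x - riemannianGradient M f x‖ ^ 2 ∂D ≤ σ ^ 2

/-- Almost surely, `F · ξ` is differentiable at the points of the convex hull of `M`, its Euclidean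
gradient is bounded by `χ` on `M`, and it is `l`-Lipschitz on the convex hull of `M`. -/
def IsSmoothOracle {p r : ℕ} {Ξ : Type*} [MeasurableSpace Ξ] (M : Set (MatSpace p r))
    (D : Measure Ξ) (F : MatSpace p r → Ξ → ℝ) (χ l : ℝ) : Prop :=
  ∀ᵐ ξ ∂D,
    (∀ x ∈ convexHull ℝ M, DifferentiableAt ℝ (fun z => F z ξ) x) ∧
    (∀ x ∈ M, ‖gradient (fun z => F z ξ) x‖ ≤ χ) ∧
    ∀ x ∈ convexHull ℝ M, ∀ y ∈ convexHull ℝ M,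
      ‖gradient (fun z => F z ξ) x - gradient (fun z => F z ξ) y‖ ≤ l * ‖x - y‖

/-- The zeroth-order projection-based Riemannian gradient estimator at `x`, with smoothing
parameter `μ`, perturbations `u 1, …, u m` and samples `ξ 1, …, ξ m`. -/
def zerothOrderEstimator {p r m : ℕ} {Ξ : Type*} (M : Set (MatSpace p r))
    (F : MatSpace p r → Ξ → ℝ) (μ : ℝ) (x : MatSpace p r)
    (u : Fin m → MatSpace p r) (ξ : Fin m → Ξ) : MatSpace p r :=
  ((p * r : ℝ) / m) •
    ∑ j, ((F (projOnto M (x + μ • u j)) (ξ j) - F x (ξ j)) / μ) • u j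

end

/-! ### Nearest points, and how far normal rays extend under proximal smoothness -/

section NearestPoint

variable {p r : ℕ} {M : Set (MatSpace p r)} {s x y z n : MatSpace p r} {R t : ℝ}

/-! The estimator is an average of `m` independent copies of `singleSampleEstimator`. When the
squared norm of its error is expanded, independence bounds each cross term by the squared norm of
the bias, and each diagonal term is at most `K ^ 2` if `K` bounds a single error almost surely
(`integral_norm_sq_average_le`). It therefore suffices that `K = O(pr)` and that the bias is `O(pr
μ)`.

For the bias, `pr · E[⟪a, u⟫ u] = a` on the unit sphere (`integral_inner_smul_uniformUnitSphere`),
so the difference quotient only has to equal `⟪grad F, u⟫ + O(μ)` uniformly. This follows from a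
first-order expansion of `F` on the convex hull of `M` together with `P(x + v) = x + P_T v +
O(‖v‖²)`, where `T` is the tangent space at `x` and the constant depends only on `γ`
(`IsEmbeddedSubmanifold.norm_sub_starProjection_le`).

That expansion of the projection is the geometric core, and it is obtained without differentiating
the projection. With `R = 2γ`, a normal ray from `x` keeps `x` as nearest point up to length `R`,
which yields `|⟪n, y - x⟫| ≤ ‖n‖ ‖y - x‖² / (2R)` for normals `n` at `x`
(`IsEmbeddedSubmanifold.abs_inner_normal_le`). A differential inequality then shows that tangent
lines leave `M` at most quadratically (`IsEmbeddedSubmanifold.infDist_tangent_le`). Hence normals at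
`z` are orthogonal to tangents at `x` up to a multiple of `‖x - z‖`, and splitting the error of the
projection into normal and tangential parts finishes the estimate. -/

theorem IsNearestPoint.norm_le (h : IsNearestPoint M s z) (hy : y ∈ M) : ‖s - z‖ ≤ ‖s - y‖ := by
  have := h.2 y hy
  exact (sq_le_sq₀ (norm_nonneg _) (norm_nonneg _)).1 (by linarith)

theorem isNearestPoint_of_norm_le (hz : z ∈ M) (h : ∀ y ∈ M, ‖s - z‖ ≤ ‖s - y‖) :
    IsNearestPoint M s z := by
  refine ⟨hz, fun y hy => ?_⟩
  have := (sq_le_sq₀ (norm_nonneg _) (norm_nonneg _)).2 (h y hy)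
  linarith

theorem IsNearestPoint.infDist_eq (h : IsNearestPoint M s z) : Metric.infDist s M = ‖s - z‖ := by
  refine le_antisymm ?_ ?_
  · rw [← dist_eq_norm]; exact Metric.infDist_le_dist_of_mem h.1
  · refine (Metric.le_infDist ⟨z, h.1⟩).2 fun y hy => ?_
    rw [dist_eq_norm]; exact h.norm_le hy

theorem IsCompact.exists_isNearestPoint (hM : IsCompact M) (hne : M.Nonempty)
    (s : MatSpace p r) : ∃ z, IsNearestPoint M s z := by
  obtain ⟨z, hz, hd⟩ := hM.exists_infDist_eq_dist hne s
  refine ⟨z, isNearestPoint_of_norm_le hz fun y hy => ?_⟩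
  rw [← dist_eq_norm, ← dist_eq_norm, ← hd]
  exact Metric.infDist_le_dist_of_mem hy

theorem isNearestPoint_projOnto (hM : IsCompact M) (hne : M.Nonempty) (s : MatSpace p r) :
    IsNearestPoint M s (projOnto M s) :=
  Classical.epsilon_spec (hM.exists_isNearestPoint hne s)

/-- Passing to the limit in the minimality inequality, every cluster point of nearest points of `t →
s` is a nearest point of `s`; uniqueness and compactness turn this into convergence. -/
theorem continuousAt_projOnto (hM : IsCompact M) (hne : M.Nonempty)
    (hs : ∃! z, IsNearestPoint M s z) : ContinuousAt (projOnto M) s := by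
  have hP := isNearestPoint_projOnto hM hne
  refine hM.tendsto_nhds_of_unique_mapClusterPt (Filter.Eventually.of_forall fun t => (hP t).1) ?_
  intro y hy hcl
  refine hs.unique (isNearestPoint_of_norm_le hy fun q hq => ?_) (hP s)
  obtain ⟨U, hU, hUy⟩ := mapClusterPt_iff_ultrafilter.1 hcl
  have hUs : Filter.Tendsto (fun t => t) (U : Filter (MatSpace p r)) (𝓝 s) := hU
  exact le_of_tendsto_of_tendsto (hUs.sub hUy).norm (hUs.sub_const q).norm
    (Filter.Eventually.of_forall fun t => (hP t).norm_le hq)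

theorem IsNearestPoint.of_segment (h : IsNearestPoint M z x) (ht : 0 ≤ t) (ht1 : t ≤ 1) :
    IsNearestPoint M (x + t • (z - x)) x := by
  refine isNearestPoint_of_norm_le h.1 fun y hy => ?_
  have h1 := h.norm_le hy
  have h2 : ‖z - y‖ ≤ ‖x + t • (z - x) - y‖ + ‖(1 - t) • (z - x)‖ := by
    refine le_trans (le_of_eq ?_) (norm_add_le _ _)
    congr 1; module
  rw [norm_smul, Real.norm_of_nonneg (by linarith)] at h2
  rw [add_sub_cancel_left, norm_smul, Real.norm_of_nonneg ht]
  linarith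

/-- The squared distance to a compact set grows at least at rate `2 ⟪h, z - P z⟫` in direction `h`,
so at a maximiser over a set every feasible direction `h` has `⟪h, z - P z⟫ ≤ 0`. -/
theorem inner_sub_projOnto_nonpos_of_isMaxOn (hM : IsCompact M) (hne : M.Nonempty)
    {B : Set (MatSpace p r)} (hz : ∃! q, IsNearestPoint M z q)
    (hmax : ∀ w ∈ B, Metric.infDist w M ≤ Metric.infDist z M) {h : MatSpace p r}
    (hh : ∀ᶠ t in 𝓝[>] (0 : ℝ), z + t • h ∈ B) : inner ℝ h (z - projOnto M z) ≤ 0 := by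
  have hP := isNearestPoint_projOnto hM hne
  have hc : ContinuousAt (fun t : ℝ => inner ℝ h (z - projOnto M (z + t • h))) 0 := by
    have h1 : ContinuousAt (projOnto M) (z + (0 : ℝ) • h) := by
      simpa using continuousAt_projOnto hM hne hz
    have h2 : ContinuousAt (fun t : ℝ => projOnto M (z + t • h)) 0 :=
      ContinuousAt.comp (f := fun t : ℝ => z + t • h) h1 (by fun_prop)
    fun_prop
  have hlim : Filter.Tendsto (fun t : ℝ => inner ℝ h (z - projOnto M (z + t • h))) (𝓝[>] 0)
      (𝓝 (inner ℝ h (z - projOnto M z))) := by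
    simpa [ContinuousAt] using hc.tendsto.mono_left nhdsWithin_le_nhds
  refine le_of_tendsto hlim ?_
  filter_upwards [hh, self_mem_nhdsWithin] with t ht ht0
  have ht0 : 0 < t := ht0
  have h1 := hmax _ ht
  rw [(hP _).infDist_eq, (hP z).infDist_eq] at h1
  have h2 := (hP z).norm_le (hP (z + t • h)).1
  have h3 := (sq_le_sq₀ (norm_nonneg _) (norm_nonneg _)).2 (h1.trans h2)
  have h4 : z + t • h - projOnto M (z + t • h) = (z - projOnto M (z + t • h)) + t • h := by abel
  rw [h4, norm_add_sq_real, inner_smul_right, real_inner_comm] at h3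
  have h5 : 0 ≤ ‖t • h‖ ^ 2 := by positivity
  have h6 : 0 ≤ t * (-inner ℝ h (z - projOnto M (z + t • h))) := by linarith
  have := nonneg_of_mul_nonneg_right h6 ht0
  linarith

/-- A nearest point along a normal ray stays nearest a little further out. -/
theorem IsProximallySmooth.extend_ray (hM : IsCompact M) (hR : IsProximallySmooth M R)
    (hn : ‖n‖ = 1) (hx : IsNearestPoint M (x + t • n) x) {ε : ℝ} (hε : 0 < ε) (hεt : ε < t)
    (hεR : t + ε < R) : IsNearestPoint M (x + (t + ε) • n) x := by
  have hne : M.Nonempty := ⟨x, hx.1⟩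
  have ht : 0 < t := hε.trans hεt
  set s := x + t • n with hs
  have hds : Metric.infDist s M = t := by
    rw [hx.infDist_eq, hs, add_sub_cancel_left, norm_smul, hn, Real.norm_of_nonneg ht.le, mul_one]
  -- A farthest point `z` from `M` in the ball around `s` is shown to be `x + (t + ε) • n`, with
  -- nearest point `x`.
  obtain ⟨z, hzB, hmax⟩ := (isCompact_closedBall s ε).exists_isMaxOn
    ⟨s, Metric.mem_closedBall_self hε.le⟩ (Metric.continuous_infDist_pt M).continuousOn
  have hzs : ‖z - s‖ ≤ ε := by rw [← dist_eq_norm]; exact hzB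
  have hdz : t ≤ Metric.infDist z M := by
    rw [← hds]; exact hmax (Metric.mem_closedBall_self hε.le)
  have hdz' : Metric.infDist z M < R := by
    have := Metric.infDist_le_infDist_add_dist (s := M) (x := z) (y := s)
    rw [hds, dist_eq_norm] at this
    linarith
  have hP := isNearestPoint_projOnto hM hne z
  have huz := hR z hdz'
  set q := projOnto M z with hq
  have hanorm : Metric.infDist z M = ‖z - q‖ := hP.infDist_eq
  have key : ∀ h : MatSpace p r, (∀ᶠ τ in 𝓝[>] (0 : ℝ), z + τ • h ∈ Metric.closedBall s ε) →
      inner ℝ h (z - q) ≤ 0 := fun h hh =>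
    inner_sub_projOnto_nonpos_of_isMaxOn hM hne huz (fun w hw => hmax hw) hh
  have hapos : 0 < ‖z - q‖ := by linarith
  -- At an interior point, moving along `z - q` would increase the distance.
  have hbε : ‖z - s‖ = ε := by
    by_contra hlt
    have hlt : ‖z - s‖ < ε := lt_of_le_of_ne hzs hlt
    have h1 := key (z - q) (by
      have hc : ContinuousAt (fun τ : ℝ => z + τ • (z - q)) 0 := by fun_prop
      have hmem : Metric.ball s ε ∈ 𝓝 (z + (0 : ℝ) • (z - q)) := by
        refine Metric.isOpen_ball.mem_nhds ?_
        simpa [dist_eq_norm] using hlt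
      exact Filter.Eventually.mono (nhdsWithin_le_nhds (hc hmem)) fun τ hτ =>
        Metric.ball_subset_closedBall hτ)
    rw [real_inner_self_eq_norm_sq] at h1
    nlinarith
  -- Equality in Cauchy–Schwarz: otherwise `‖b‖ • a - ‖a‖ • b` points strictly into the ball and has
  -- positive inner product with `a = z - q`, against maximality.
  have hcs : inner ℝ (z - q) (z - s) = ‖z - q‖ * ‖z - s‖ := by
    by_contra hlt
    have hlt : inner ℝ (z - q) (z - s) < ‖z - q‖ * ‖z - s‖ :=
      lt_of_le_of_ne (real_inner_le_norm _ _) hlt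
    set a := z - q
    set b := z - s with hb
    have h1 := key (‖b‖ • a - ‖a‖ • b) (by
      set h := ‖b‖ • a - ‖a‖ • b
      have hhb : inner ℝ b h < 0 := by
        simp only [h, inner_sub_right, inner_smul_right, real_inner_self_eq_norm_sq]
        rw [real_inner_comm]
        have : 0 < ‖b‖ := by linarith
        nlinarith
      have hlim : Filter.Tendsto (fun τ : ℝ => 2 * inner ℝ b h + τ * ‖h‖ ^ 2) (𝓝[>] 0)
          (𝓝 (2 * inner ℝ b h + 0 * ‖h‖ ^ 2)) :=
        (Continuous.tendsto (by fun_prop) 0).mono_left nhdsWithin_le_nhds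
      filter_upwards [hlim.eventually (gt_mem_nhds (show _ < (0 : ℝ) by linarith)),
        self_mem_nhdsWithin] with τ hτ hτ0
      have hτ0 : 0 < τ := hτ0
      rw [Metric.mem_closedBall, dist_eq_norm, show z + τ • h - s = b + τ • h by rw [hb]; abel]
      refine (sq_le_sq₀ (norm_nonneg _) hε.le).1 ?_
      rw [norm_add_sq_real, inner_smul_right, norm_smul, mul_pow, Real.norm_eq_abs, sq_abs, hbε]
      nlinarith)
    rw [inner_sub_left, inner_smul_left, inner_smul_left, real_inner_self_eq_norm_sq,
      real_inner_comm] at h1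
    simp only [conj_trivial] at h1
    nlinarith
  have hray : ‖z - s‖ • (z - q) = ‖z - q‖ • (z - s) :=
    (inner_eq_norm_mul_iff_real.1 hcs)
  set c := ‖z - q‖ with hc
  have hεc : ε < c := by linarith
  have hzs' : z - s = (ε / c) • (z - q) := by
    rw [hbε] at hray
    rw [div_eq_inv_mul, mul_smul, hray, smul_smul, inv_mul_cancel₀ hapos.ne', one_smul]
  -- So `s` lies on the segment from `q` to `z`. Then `q` is also nearest to `s`, and uniqueness
  -- gives `q = x`.
  have hs' : s = q + (1 - ε / c) • (z - q) := by
    have : s = z - (z - s) := by abel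
    rw [this, hzs']; module
  have h0 : 0 < 1 - ε / c := by rw [sub_pos, div_lt_one hapos]; exact hεc
  have hqs : IsNearestPoint M s q := by
    rw [hs']
    exact hP.of_segment h0.le (by have : 0 ≤ ε / c := by positivity
                                  linarith)
  have hqx : q = x := (hR s (by linarith)).unique hqs hx
  rw [hqx] at hs' hP
  have h1 : t • n = (1 - ε / c) • (z - x) := by
    have := hs'.symm.trans hs
    exact (add_left_cancel this).symm
  have hct : c = t + ε := by
    have h2 := congrArg norm h1
    rw [norm_smul, norm_smul, hn, Real.norm_of_nonneg ht.le, Real.norm_of_nonneg h0.le, ← hqx,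
      ← hc] at h2
    field_simp at h2
    linarith
  have hzx : z = x + (t + ε) • n := by
    have h2 : (t + ε) • n = ((t + ε) / t) • (t • n) := by
      rw [smul_smul, div_mul_cancel₀ _ ht.ne']
    rw [h2, h1, smul_smul, hct]
    have : (t + ε) / t * (1 - ε / (t + ε)) = 1 := by field_simp; ring
    rw [this, one_smul]; abel
  rwa [← hzx]

/-- Continuity method: the admissible lengths form a closed set, and `extend_ray` supplies larger
ones arbitrarily close to each admissible length below `τ`. -/
theorem IsProximallySmooth.isNearestPoint_ray (hM : IsCompact M) (hR : IsProximallySmooth M R)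
    (hn : ‖n‖ = 1) (ht : 0 < t) (hx : IsNearestPoint M (x + t • n) x) {τ : ℝ} (htτ : t ≤ τ)
    (hτR : τ < R) : IsNearestPoint M (x + τ • n) x := by
  have hcl : IsClosed {a : ℝ | IsNearestPoint M (x + a • n) x} := by
    have : {a : ℝ | IsNearestPoint M (x + a • n) x} =
        ⋂ y ∈ M, {a : ℝ | ‖x + a • n - x‖ ≤ ‖x + a • n - y‖} := by
      ext a
      simp only [mem_ofPred_eq, mem_iInter]
      exact ⟨fun h y hy => h.norm_le hy, isNearestPoint_of_norm_le hx.1⟩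
    rw [this]
    exact isClosed_biInter fun y _ => isClosed_le (by fun_prop) (by fun_prop)
  have hsub : Icc t τ ⊆ {a : ℝ | IsNearestPoint M (x + a • n) x} := by
    refine IsClosed.Icc_subset_of_forall_exists_gt (hcl.inter isClosed_Icc) hx ?_
    rintro a ⟨ha, hta, haτ⟩ b hab
    have hab : a < b := hab
    set ε := min (min (t / 2) (b - a)) (τ - a)
    have h1 : ε ≤ t / 2 := (min_le_left _ _).trans (min_le_left _ _)
    have h2 : ε ≤ b - a := (min_le_left _ _).trans (min_le_right _ _)
    have h3 : ε ≤ τ - a := min_le_right _ _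
    have h4 : 0 < ε := lt_min (lt_min (by linarith) (by linarith)) (by linarith)
    exact ⟨a + ε, hR.extend_ray hM hn ha h4 (by linarith) (by linarith), by simpa using h4,
      by linarith⟩
  exact hsub ⟨htτ, le_rfl⟩

theorem IsNearestPoint.inner_le (h : IsNearestPoint M (x + n) x) (hy : y ∈ M) :
    2 * inner ℝ n (y - x) ≤ ‖y - x‖ ^ 2 := by
  have h1 := (sq_le_sq₀ (norm_nonneg _) (norm_nonneg _)).2 (h.norm_le hy)
  rw [show x + n - y = n - (y - x) by abel, add_sub_cancel_left, norm_sub_sq_real] at h1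
  linarith

/-- For a unit normal the ball of radius `τ` centred at distance `τ` along the ray has no point of
`M` in its interior, for all `τ < R`; the bound is the limit `τ → R`, and is linear in `n`. -/
theorem IsProximallySmooth.inner_le (hM : IsCompact M) (hR : IsProximallySmooth M R)
    (hR0 : 0 < R) (ht : 0 < t) (hx : IsNearestPoint M (x + t • n) x) (hy : y ∈ M) :
    inner ℝ n (y - x) ≤ ‖n‖ * ‖y - x‖ ^ 2 / (2 * R) := by
  rcases eq_or_ne n 0 with rfl | hn0
  · simp
  have hnpos : 0 < ‖n‖ := norm_pos_iff.2 hn0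
  set e := ‖n‖⁻¹ • n with he
  have hen : ‖e‖ = 1 := by rw [he, norm_smul, norm_inv, norm_norm, inv_mul_cancel₀ hnpos.ne']
  have hne : n = ‖n‖ • e := by rw [he, smul_smul, mul_inv_cancel₀ hnpos.ne', one_smul]
  -- The cap `R / 2` keeps the starting length below `R`, so that there is room for the limit.
  set t' := min (t * ‖n‖) (R / 2)
  have ht' : 0 < t' := lt_min (by positivity) (by positivity)
  have hx' : IsNearestPoint M (x + t' • e) x := by
    have h := hx.of_segment (t := t' / (t * ‖n‖)) (by positivity)
      ((div_le_one (by positivity)).2 (min_le_left _ _))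
    convert h using 2
    rw [add_sub_cancel_left, he, smul_smul, smul_smul]
    congr 1; field_simp
  have key : ∀ τ ∈ Ioo t' R, 2 * τ * inner ℝ e (y - x) ≤ ‖y - x‖ ^ 2 := fun τ hτ => by
    have := (hR.isNearestPoint_ray hM hen ht' hx' hτ.1.le hτ.2).inner_le hy
    rw [inner_smul_left] at this
    simpa [mul_assoc] using this
  have h2 : 2 * R * inner ℝ e (y - x) ≤ ‖y - x‖ ^ 2 := by
    have hlim : Filter.Tendsto (fun τ : ℝ => 2 * τ * inner ℝ e (y - x)) (𝓝[<] R)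
        (𝓝 (2 * R * inner ℝ e (y - x))) :=
      (Continuous.tendsto (by fun_prop) R).mono_left nhdsWithin_le_nhds
    refine le_of_tendsto hlim ?_
    filter_upwards [Ioo_mem_nhdsLT (show t' < R from (min_le_right _ _).trans_lt (by linarith))]
      with τ hτ using key τ hτ
  rw [le_div_iff₀ (by positivity)]
  have h3 : inner ℝ n (y - x) = ‖n‖ * inner ℝ e (y - x) := by
    conv_lhs => rw [hne]
    rw [inner_smul_left]; simp
  rw [h3]
  nlinarith

end NearestPoint

/-! ### Curves, tangent vectors and proximal normals of the submanifold -/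

section TangentSpace

variable {p r k : ℕ} {M : Set (MatSpace p r)} {x y z n τ v : MatSpace p r} {R : ℝ}

theorem IsSmoothCurveAt.hasDerivAt {c : ℝ → MatSpace p r} (hc : IsSmoothCurveAt M x c) :
    HasDerivAt c (deriv c 0) 0 := by
  obtain ⟨-, ε, hε, hsm, -⟩ := hc
  exact ((hsm.contDiffAt (Ioo_mem_nhds (by linarith) hε)).differentiableAt
    (by simp)).hasDerivAt

theorem IsSmoothCurveAt.eventually_mem {c : ℝ → MatSpace p r} (hc : IsSmoothCurveAt M x c) :
    ∀ᶠ t in 𝓝 0, c t ∈ M := by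
  obtain ⟨-, ε, hε, -, hm⟩ := hc
  filter_upwards [Ioo_mem_nhds (show -ε < 0 by linarith) hε] with t ht using hm t ht

/-- Every vector in the kernel of the derivative of a local defining function is the velocity of a
smooth curve. -/
theorem exists_isSmoothCurveAt_of_fderiv_eq_zero {U : Set (MatSpace p r)} (hU : IsOpen U)
    (hxU : x ∈ U) (hx : x ∈ M) {h : MatSpace p r → EuclideanSpace ℝ (Fin k)}
    (hh : ContDiffOn ℝ ∞ h U) (hM : ∀ y ∈ U, y ∈ M ↔ h y = 0)
    {B : EuclideanSpace ℝ (Fin k) →L[ℝ] MatSpace p r} (hB : ∀ w, fderiv ℝ h x (B w) = w)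
    (hv : fderiv ℝ h x v = 0) :
    ∃ c : ℝ → MatSpace p r, IsSmoothCurveAt M x c ∧ deriv c 0 = v := by
  -- Move by `t • v` and correct by `B w`. Since `h' v = 0` and `h' B = id`, the map `(t, w) ↦ (t, h
  -- (a (t, w)))` has derivative the identity at `0`; its local inverse along `(t, 0)` gives the
  -- curve.
  let a : ℝ × EuclideanSpace ℝ (Fin k) → MatSpace p r := fun q => x + q.1 • v + B q.2
  have ha : ContDiff ℝ ∞ a := by fun_prop
  have ha0 : a 0 = x := by simp [a]
  let Ψ : ℝ × EuclideanSpace ℝ (Fin k) → ℝ × EuclideanSpace ℝ (Fin k) := fun q => (q.1, h (a q))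
  have hΨat : ∀ q, a q ∈ U → ContDiffAt ℝ ∞ Ψ q := fun q hq =>
    contDiffAt_fst.prodMk ((hh.contDiffAt (hU.mem_nhds hq)).comp q ha.contDiffAt)
  have hΨ0 : ContDiffAt ℝ ∞ Ψ 0 := hΨat 0 (ha0 ▸ hxU)
  have hΨz : Ψ 0 = 0 := by
    have : h x = 0 := (hM x hxU).1 hx
    simp [Ψ, ha0, this]
  have hhx : HasFDerivAt h (fderiv ℝ h x) (a 0) := by
    rw [ha0]
    exact ((hh.contDiffAt (hU.mem_nhds hxU)).differentiableAt (by simp)).hasFDerivAt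
  have hda : HasFDerivAt a ((ContinuousLinearMap.fst ℝ ℝ (EuclideanSpace ℝ (Fin k))).smulRight v +
      B ∘L ContinuousLinearMap.snd ℝ ℝ _) 0 := by
    have h1 : HasFDerivAt (fun q : ℝ × EuclideanSpace ℝ (Fin k) => x + q.1 • v)
        ((ContinuousLinearMap.fst ℝ ℝ (EuclideanSpace ℝ (Fin k))).smulRight v) 0 :=
      (hasFDerivAt_fst.smul_const v).const_add x
    exact h1.add (B ∘L ContinuousLinearMap.snd ℝ ℝ _).hasFDerivAt
  have hΨ' : HasFDerivAt Ψ ((ContinuousLinearEquiv.refl ℝ (ℝ × EuclideanSpace ℝ (Fin k)) :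
      _ ≃L[ℝ] _) : _ →L[ℝ] _) 0 := by
    refine (hasFDerivAt_fst.prodMk (hhx.comp 0 hda)).congr_fderiv ?_
    ext q <;> simp [hB, hv]
  let Φ := hΨ0.toOpenPartialHomeomorph Ψ hΨ' (by simp)
  have hΦcoe : ∀ q, Φ q = Ψ q := fun q => rfl
  have hs0 : (0 : ℝ × EuclideanSpace ℝ (Fin k)) ∈ Φ.source :=
    hΨ0.mem_toOpenPartialHomeomorph_source hΨ' (by simp)
  have ht0 : (0 : ℝ × EuclideanSpace ℝ (Fin k)) ∈ Φ.target := by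
    have := Φ.map_source hs0
    rwa [hΦcoe, hΨz] at this
  have hsymm0 : Φ.symm 0 = 0 := by
    have := Φ.left_inv hs0
    rwa [hΦcoe, hΨz] at this
  have hsymm0' : Φ.symm ((0 : ℝ), (0 : EuclideanSpace ℝ (Fin k))) = 0 := hsymm0
  -- The curve must be smooth on an interval, so the derivative of `Ψ` has to be invertible near `0`
  -- as well.
  have hgood : ∀ᶠ q in 𝓝 (0 : ℝ × EuclideanSpace ℝ (Fin k)),
      a q ∈ U ∧ ∃ e : (ℝ × EuclideanSpace ℝ (Fin k)) ≃L[ℝ] (ℝ × EuclideanSpace ℝ (Fin k)),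
        (e : _ →L[ℝ] _) = fderiv ℝ Ψ q := by
    refine Filter.Eventually.and (ha.continuous.continuousAt (hU.mem_nhds (ha0 ▸ hxU))) ?_
    have hc : ContinuousAt (fderiv ℝ Ψ) 0 := hΨ0.continuousAt_fderiv (by simp)
    have hn := ContinuousLinearEquiv.nhds (ContinuousLinearEquiv.refl ℝ
      (ℝ × EuclideanSpace ℝ (Fin k)))
    rw [← hΨ'.fderiv] at hn
    exact hc hn
  have hcs : ContinuousAt (fun t : ℝ => Φ.symm (t, 0)) 0 :=
    ContinuousAt.comp (f := fun t : ℝ => (t, (0 : EuclideanSpace ℝ (Fin k))))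
      (Φ.continuousAt_symm ht0) (by fun_prop)
  have hev : ∀ᶠ t : ℝ in 𝓝 0, (t, (0 : EuclideanSpace ℝ (Fin k))) ∈ Φ.target ∧
      (a (Φ.symm (t, 0)) ∈ U ∧
        ∃ e : (ℝ × EuclideanSpace ℝ (Fin k)) ≃L[ℝ] (ℝ × EuclideanSpace ℝ (Fin k)),
        (e : _ →L[ℝ] _) = fderiv ℝ Ψ (Φ.symm (t, 0))) := by
    refine Filter.Eventually.and ?_ ?_
    · have hc : ContinuousAt (fun t : ℝ => (t, (0 : EuclideanSpace ℝ (Fin k)))) 0 := by fun_prop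
      exact hc (Φ.open_target.mem_nhds ht0)
    · have hcs' := hcs.tendsto
      rw [hsymm0'] at hcs'
      exact hcs'.eventually hgood
  obtain ⟨ε, hε, hball⟩ := Metric.eventually_nhds_iff.1 hev
  have hΦd : HasFDerivAt Φ.symm (((ContinuousLinearEquiv.refl ℝ
      (ℝ × EuclideanSpace ℝ (Fin k))).symm : _ ≃L[ℝ] _) : _ →L[ℝ] _)
      ((0 : ℝ), (0 : EuclideanSpace ℝ (Fin k))) := by
    refine Φ.hasFDerivAt_symm ht0 ?_
    rw [hsymm0']; exact hΨ'
  have hcurve : HasDerivAt (fun t : ℝ => Φ.symm (t, 0)) (1, 0) 0 := by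
    have h1 : HasDerivAt (fun t : ℝ => (t, (0 : EuclideanSpace ℝ (Fin k)))) (1, 0) 0 :=
      (hasDerivAt_id 0).prodMk (hasDerivAt_const _ _)
    exact (hΦd.comp_hasDerivAt (0 : ℝ) h1).congr_deriv (by simp)
  refine ⟨fun t => a (Φ.symm (t, 0)), ⟨?_, ε, hε, ?_, ?_⟩, ?_⟩
  · change a (Φ.symm 0) = x
    rw [hsymm0, ha0]
  · intro t ht
    obtain ⟨h1, h2, e, he⟩ := hball (y := t) (by rw [Real.dist_eq, sub_zero]; exact abs_lt.2 ht)
    have hd : HasFDerivAt Φ (e : _ →L[ℝ] _) (Φ.symm (t, 0)) := by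
      rw [he]
      exact ((hΨat _ h2).differentiableAt (by simp)).hasFDerivAt
    have h3 : ContDiffAt ℝ ∞ Φ.symm (t, 0) := Φ.contDiffAt_symm h1 hd (hΨat _ h2)
    have h4 : ContDiffAt ℝ ∞ (fun t : ℝ => Φ.symm (t, (0 : EuclideanSpace ℝ (Fin k)))) t :=
      ContDiffAt.comp (f := fun t : ℝ => (t, (0 : EuclideanSpace ℝ (Fin k)))) t h3 (by fun_prop)
    exact (ha.contDiffAt.comp t h4).contDiffWithinAt
  · intro t ht
    obtain ⟨h1, h2, -⟩ := hball (y := t) (by rw [Real.dist_eq, sub_zero]; exact abs_lt.2 ht)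
    refine (hM _ h2).2 ?_
    exact congrArg Prod.snd (Φ.right_inv h1)
  · rw [← hsymm0'] at hda
    have := hda.comp_hasDerivAt (0 : ℝ) hcurve
    exact this.deriv.trans (by simp)

theorem exists_continuousLinearMap_rightInverse {h' : MatSpace p r →L[ℝ] EuclideanSpace ℝ (Fin k)}
    (hs : Function.Surjective h') :
    ∃ B : EuclideanSpace ℝ (Fin k) →L[ℝ] MatSpace p r, ∀ w, h' (B w) = w := by
  obtain ⟨g, hg⟩ := h'.toLinearMap.exists_rightInverse_of_surjective
    (LinearMap.range_eq_top.2 hs)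
  exact ⟨LinearMap.toContinuousLinearMap g, fun w => LinearMap.congr_fun hg w⟩

theorem fderiv_eq_zero_of_mem_tangentSpaceAt {U : Set (MatSpace p r)} (hU : IsOpen U)
    (hxU : x ∈ U) {h : MatSpace p r → EuclideanSpace ℝ (Fin k)}
    (hh : ContDiffOn ℝ ∞ h U) (hM : ∀ y ∈ U, y ∈ M ↔ h y = 0)
    (hv : v ∈ tangentSpaceAt M x) : fderiv ℝ h x v = 0 := by
  have hle : tangentSpaceAt M x ≤ LinearMap.ker (fderiv ℝ h x).toLinearMap := by
    refine Submodule.span_le.2 ?_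
    rintro w ⟨c, hc, rfl⟩
    have hhx : HasFDerivAt h (fderiv ℝ h x) (c 0) := by
      rw [hc.1]
      exact ((hh.contDiffAt (hU.mem_nhds hxU)).differentiableAt (by simp)).hasFDerivAt
    have h1 := hhx.comp_hasDerivAt (0 : ℝ) hc.hasDerivAt
    have h2 : h ∘ c =ᶠ[𝓝 0] fun _ => 0 := by
      have hcU : ∀ᶠ t in 𝓝 0, c t ∈ U :=
        hc.hasDerivAt.continuousAt (hU.mem_nhds (by rw [hc.1]; exact hxU))
      filter_upwards [hc.eventually_mem, hcU] with t ht htU using (hM _ htU).1 ht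
    exact (h1.unique ((hasDerivAt_const (0 : ℝ) _).congr_of_eventuallyEq h2) :)
  exact hle hv

theorem IsEmbeddedSubmanifold.exists_curve (hM : IsEmbeddedSubmanifold M) (hx : x ∈ M)
    (hv : v ∈ tangentSpaceAt M x) :
    ∃ c : ℝ → MatSpace p r, IsSmoothCurveAt M x c ∧ deriv c 0 = v := by
  obtain ⟨k, hk⟩ := hM
  obtain ⟨U, hU, hxU, h, hh, hMU, hs⟩ := hk x hx
  obtain ⟨B, hB⟩ := exists_continuousLinearMap_rightInverse hs
  exact exists_isSmoothCurveAt_of_fderiv_eq_zero hU hxU hx hh hMU hB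
    (fderiv_eq_zero_of_mem_tangentSpaceAt hU hxU hh hMU hv)

theorem ContDiffAt.exists_taylor_one_bound {F : Type*} [NormedAddCommGroup F] [NormedSpace ℝ F]
    {h : MatSpace p r → F} (hh : ContDiffAt ℝ 2 h x) :
    ∃ K δ : ℝ, 0 ≤ K ∧ 0 < δ ∧ ∀ y ∈ Metric.ball x δ,
      ‖h y - h x - fderiv ℝ h x (y - x)‖ ≤ K * ‖y - x‖ ^ 2 := by
  have h1 : ContDiffAt ℝ 1 (fderiv ℝ h) x := hh.fderiv_right (by norm_num)
  obtain ⟨K, s, hs, hK⟩ := h1.exists_lipschitzOnWith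
  have hd : ∀ᶠ y in 𝓝 x, DifferentiableAt ℝ h y :=
    (hh.eventually (by simp)).mono fun y hy => hy.differentiableAt (by simp)
  obtain ⟨δ, hδ, hball⟩ := Metric.eventually_nhds_iff_ball.1 (hd.and hs)
  refine ⟨K, δ, K.2, hδ, fun y hy => ?_⟩
  have hyx : ‖y - x‖ < δ := by rw [← dist_eq_norm]; exact hy
  have hsub : segment ℝ x y ⊆ Metric.ball x δ :=
    (convex_ball x δ).segment_subset (Metric.mem_ball_self hδ) hy
  have := (convex_segment x y).norm_image_sub_le_of_norm_hasFDerivWithin_le'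
    (f := h) (f' := fderiv ℝ h) (φ := fderiv ℝ h x) (C := K * ‖y - x‖)
    (fun q hq => (hball q (hsub hq)).1.hasFDerivAt.hasFDerivWithinAt) (fun q hq => by
      refine (hK.norm_sub_le (hball q (hsub hq)).2 (mem_of_mem_nhds hs)).trans ?_
      exact mul_le_mul_of_nonneg_left (norm_sub_le_of_mem_segment hq) K.2)
    (left_mem_segment ℝ x y) (right_mem_segment ℝ x y)
  calc _ ≤ _ := this
    _ = _ := by ring

/-- A vector orthogonal to the tangent space is a proximal normal. -/
theorem IsEmbeddedSubmanifold.exists_isNearestPoint (hM : IsEmbeddedSubmanifold M) (hx : x ∈ M)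
    (hn : n ∈ (tangentSpaceAt M x)ᗮ) : ∃ t : ℝ, 0 < t ∧ IsNearestPoint M (x + t • n) x := by
  obtain ⟨k, hk⟩ := hM
  obtain ⟨U, hU, hxU, h, hh, hMU, hs⟩ := hk x hx
  obtain ⟨B, hB⟩ := exists_continuousLinearMap_rightInverse hs
  have hcd : ContDiffAt ℝ ∞ h x := hh.contDiffAt (hU.mem_nhds hxU)
  obtain ⟨K, δ₁, hK, hδ₁, hbound⟩ := (contDiffAt_infty.1 hcd 2).exists_taylor_one_bound
  obtain ⟨δ₂, hδ₂, hballU⟩ := Metric.isOpen_iff.1 hU x hxU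
  set δ := min δ₁ δ₂
  have hδ : 0 < δ := lt_min hδ₁ hδ₂
  -- Near `x`, subtracting `B (h' (y - x))` makes `y - x` tangent, and this correction is quadratic
  -- by Taylor since `h y = h x = 0`. Far from `x`, `‖y - x‖ ≥ δ` absorbs the linear bound.
  set L := max (‖n‖ * ‖B‖ * K) (‖n‖ / δ)
  have hL : ∀ y ∈ M, inner ℝ n (y - x) ≤ L * ‖y - x‖ ^ 2 := fun y hy => by
    rcases lt_or_ge ‖y - x‖ δ with hlt | hge
    · have hyU : y ∈ U := hballU (by
        rw [Metric.mem_ball, dist_eq_norm]; exact hlt.trans_le (min_le_right _ _))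
      have hb := hbound y (by
        rw [Metric.mem_ball, dist_eq_norm]; exact hlt.trans_le (min_le_left _ _))
      rw [(hMU y hyU).1 hy, (hMU x hxU).1 hx, sub_zero, zero_sub, norm_neg] at hb
      have hker : (y - x) - B (fderiv ℝ h x (y - x)) ∈ tangentSpaceAt M x := by
        obtain ⟨c, hc, hcv⟩ := exists_isSmoothCurveAt_of_fderiv_eq_zero hU hxU hx hh hMU hB
          (v := (y - x) - B (fderiv ℝ h x (y - x))) (by rw [map_sub, hB, sub_self])
        exact Submodule.subset_span ⟨c, hc, hcv⟩
      have h0 := (Submodule.mem_orthogonal' _ _).1 hn _ hker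
      rw [inner_sub_right, sub_eq_zero] at h0
      rw [h0]
      calc inner ℝ n (B (fderiv ℝ h x (y - x))) ≤ ‖n‖ * ‖B (fderiv ℝ h x (y - x))‖ :=
            real_inner_le_norm _ _
        _ ≤ ‖n‖ * (‖B‖ * (K * ‖y - x‖ ^ 2)) := by
            gcongr
            exact (B.le_opNorm _).trans (by gcongr)
        _ = ‖n‖ * ‖B‖ * K * ‖y - x‖ ^ 2 := by ring
        _ ≤ L * ‖y - x‖ ^ 2 := by gcongr; exact le_max_left _ _
    · calc inner ℝ n (y - x) ≤ ‖n‖ * ‖y - x‖ := real_inner_le_norm _ _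
        _ = ‖n‖ / δ * (δ * ‖y - x‖) := by field_simp
        _ ≤ ‖n‖ / δ * (‖y - x‖ * ‖y - x‖) := by gcongr
        _ = ‖n‖ / δ * ‖y - x‖ ^ 2 := by ring
        _ ≤ L * ‖y - x‖ ^ 2 := by gcongr; exact le_max_right _ _
  have hL0 : 0 ≤ L := le_trans (by positivity) (le_max_right _ _)
  -- Chosen so that `2 * t * L ≤ 1`; the `+ 1` covers `L = 0`.
  refine ⟨1 / (2 * (L + 1)), by positivity, isNearestPoint_of_norm_le hx fun y hy => ?_⟩
  set t := 1 / (2 * (L + 1)) with ht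
  have htL : 2 * t * L ≤ 1 := by
    rw [ht]; field_simp; linarith
  have ht0 : 0 < t := by positivity
  refine (sq_le_sq₀ (norm_nonneg _) (norm_nonneg _)).1 ?_
  rw [show x + t • n - y = t • n - (y - x) by abel, add_sub_cancel_left, norm_sub_sq_real,
    inner_smul_left]
  simp only [conj_trivial]
  have h1 : 2 * (t * inner ℝ n (y - x)) ≤ ‖y - x‖ ^ 2 := by
    calc 2 * (t * inner ℝ n (y - x)) ≤ 2 * (t * (L * ‖y - x‖ ^ 2)) := by gcongr; exact hL y hy
      _ = (2 * t * L) * ‖y - x‖ ^ 2 := by ring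
      _ ≤ 1 * ‖y - x‖ ^ 2 := by gcongr
      _ = _ := one_mul _
  linarith

/-- On a proximally smooth submanifold, secants are tangent up to second order. -/
theorem IsEmbeddedSubmanifold.abs_inner_normal_le (hM : IsEmbeddedSubmanifold M)
    (hc : IsCompact M) (hR : IsProximallySmooth M R) (hR0 : 0 < R) (hx : x ∈ M) (hy : y ∈ M)
    (hn : n ∈ (tangentSpaceAt M x)ᗮ) :
    |inner ℝ n (y - x)| ≤ ‖n‖ * ‖y - x‖ ^ 2 / (2 * R) := by
  obtain ⟨t, ht, h⟩ := hM.exists_isNearestPoint hx hn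
  obtain ⟨t', ht', h'⟩ := hM.exists_isNearestPoint hx (neg_mem hn)
  have h1 := hR.inner_le hc hR0 ht h hy
  have h2 := hR.inner_le hc hR0 ht' h' hy
  rw [inner_neg_left, norm_neg] at h2
  exact abs_le.2 ⟨by linarith, h1⟩

/-- First-order condition: the squared distance to `s` along any curve through `z` has a local
minimum at time `0`. -/
theorem IsNearestPoint.sub_mem_orthogonal {s : MatSpace p r} (h : IsNearestPoint M s z) :
    s - z ∈ (tangentSpaceAt M z)ᗮ := by
  rw [← Submodule.span_singleton_le_iff_mem, Submodule.le_orthogonal_iff_le_orthogonal]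
  refine Submodule.span_le.2 ?_
  rintro w ⟨c, hc, rfl⟩
  rw [SetLike.mem_coe, Submodule.mem_orthogonal_singleton_iff_inner_right]
  have hd : HasDerivAt (fun t => ‖s - c t‖ ^ 2) (2 * inner ℝ (s - c 0) (0 - deriv c 0)) 0 :=
    ((hasDerivAt_const (0 : ℝ) s).sub hc.hasDerivAt).norm_sq
  have hmin : IsLocalMin (fun t => ‖s - c t‖ ^ 2) 0 := by
    filter_upwards [hc.eventually_mem] with t ht
    rw [hc.1]
    exact (sq_le_sq₀ (norm_nonneg _) (norm_nonneg _)).2 (h.norm_le ht)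
  have h0 := hmin.hasDerivAt_eq_zero hd
  rw [hc.1, zero_sub, inner_neg_right] at h0
  linarith

end TangentSpace

/-! ### Second-order estimates for tangent lines and for the projection -/

section SecondOrder

variable {p r : ℕ} {M : Set (MatSpace p r)} {x y z n τ v : MatSpace p r} {R : ℝ}

theorem IsEmbeddedSubmanifold.exists_infDist_le (hM : IsEmbeddedSubmanifold M) (hx : x ∈ M)
    (hτ : τ ∈ tangentSpaceAt M x) {ε b : ℝ} (hε : 0 < ε) (hb : 0 < b) :
    ∃ a, 0 < a ∧ a ≤ b ∧ Metric.infDist (x + a • τ) M ≤ ε * a := by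
  obtain ⟨c, hc, rfl⟩ := hM.exists_curve hx hτ
  have ho := (hasDerivAt_iff_isLittleO.1 hc.hasDerivAt).def hε
  have hev := nhdsWithin_le_nhds (s := Ioi 0) (ho.and hc.eventually_mem)
  obtain ⟨a, ⟨h1, h2⟩, ha⟩ := (Filter.Eventually.and hev (Ioc_mem_nhdsGT hb)).exists
  refine ⟨a, ha.1, ha.2, (Metric.infDist_le_dist_of_mem h2).trans ?_⟩
  rw [sub_zero, hc.1, Real.norm_of_nonneg ha.1.le] at h1
  rw [dist_eq_norm, ← norm_neg]
  refine le_trans (le_of_eq ?_) h1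
  congr 1; abel

/-- The residual `e s` is normal at the projected point, and the squared distance has right slope at
most `2 ⟪e s, τ⟫`. The secant inequality at that point bounds this slope by the distance itself, and
a comparison argument integrates the resulting differential inequality. -/
theorem IsEmbeddedSubmanifold.infDist_tangent_le (hM : IsEmbeddedSubmanifold M)
    (hc : IsCompact M) (hR : IsProximallySmooth M R) (hR0 : 0 < R) (hx : x ∈ M)
    (hτ : τ ∈ tangentSpaceAt M x) (hτ1 : ‖τ‖ = 1) {b : ℝ} (hb : 0 < b) :
    Metric.infDist (x + b • τ) M ≤ 3 * b ^ 2 / R := by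
  have hP := isNearestPoint_projOnto hc ⟨x, hx⟩
  set e : ℝ → MatSpace p r := fun s => x + s • τ - projOnto M (x + s • τ) with he
  have hde : ∀ s, Metric.infDist (x + s • τ) M = ‖e s‖ := fun s => (hP _).infDist_eq
  have hes : ∀ s, 0 ≤ s → ‖e s‖ ≤ s := fun s hs => by
    have := (hP (x + s • τ)).norm_le hx
    rwa [add_sub_cancel_left, norm_smul, hτ1, mul_one, Real.norm_of_nonneg hs] at this
  have hinner : ∀ s, 0 ≤ s → s * inner ℝ (e s) τ ≤ ‖e s‖ ^ 2 + 2 * ‖e s‖ * s ^ 2 / R := by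
    intro s hs
    have h1 := (abs_le.1 (hM.abs_inner_normal_le hc hR hR0 (hP (x + s • τ)).1 hx
      (hP (x + s • τ)).sub_mem_orthogonal)).1
    have h2 : x - projOnto M (x + s • τ) = e s - s • τ := by simp only [he]; abel
    have h3 : ‖e s - s • τ‖ ≤ 2 * s := by
      refine (norm_sub_le _ _).trans ?_
      rw [norm_smul, hτ1, mul_one, Real.norm_of_nonneg hs]
      linarith [hes s hs]
    change -(‖e s‖ * _ / _) ≤ inner ℝ (e s) _ at h1
    rw [h2, inner_sub_right, inner_smul_right, real_inner_self_eq_norm_sq] at h1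
    have h4 : ‖e s‖ * ‖e s - s • τ‖ ^ 2 / (2 * R) ≤ ‖e s‖ * (2 * s) ^ 2 / (2 * R) := by gcongr
    have h5 : ‖e s‖ * (2 * s) ^ 2 / (2 * R) = 2 * ‖e s‖ * s ^ 2 / R := by field_simp
    linarith
  suffices h : ∀ ε, 0 < ε → Metric.infDist (x + b • τ) M ≤ 3 * b ^ 2 / R + ε * b by
    refine le_of_forall_pos_le_add fun ε hε => ?_
    have := h (ε / b) (by positivity)
    rwa [div_mul_cancel₀ _ hb.ne'] at this
  intro ε hε
  -- The comparison starts at some `a > 0`, because its strict inequality fails at `0`. The term `ε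
  -- * s` covers the start, where only a little-o bound is available.
  obtain ⟨a, ha, hab, hda⟩ := hM.exists_infDist_le hx hτ hε hb
  have hfence := image_le_of_liminf_slope_right_lt_deriv_boundary'
    (f := fun s => Metric.infDist (x + s • τ) M ^ 2) (f' := fun s => 2 * inner ℝ (e s) τ)
    (a := a) (b := b) (B := fun s => (3 * s ^ 2 / R + ε * s) ^ 2)
    (B' := fun s => 2 * (3 * s ^ 2 / R + ε * s) * (6 * s / R + ε))
    (by
      have : Continuous fun s : ℝ => Metric.infDist (x + s • τ) M :=
        (Metric.continuous_infDist_pt M).comp (by fun_prop)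
      exact (this.pow 2).continuousOn)
    (fun s _ ρ hρ => by
      refine Filter.Eventually.frequently ?_
      filter_upwards [Ioo_mem_nhdsGT (show s < s + (ρ - 2 * inner ℝ (e s) τ) by linarith)]
        with q hq
      have hqs : 0 < q - s := by linarith [hq.1]
      rw [slope_def_field, div_lt_iff₀ hqs]
      -- The nearest point at parameter `s` competes at parameter `q`.
      have h1 : Metric.infDist (x + q • τ) M ≤ ‖e s + (q - s) • τ‖ := by
        rw [hde]
        refine ((hP _).norm_le (hP (x + s • τ)).1).trans (le_of_eq ?_)
        congr 1; simp only [he]; module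
      have h2 := pow_le_pow_left₀ Metric.infDist_nonneg h1 2
      rw [norm_add_sq_real, norm_smul, hτ1, inner_smul_right, mul_one, Real.norm_eq_abs,
        sq_abs] at h2
      rw [hde s]
      nlinarith [hq.2])
    (pow_le_pow_left₀ Metric.infDist_nonneg (hda.trans (by
      have : 0 ≤ 3 * a ^ 2 / R := by positivity
      linarith)) 2)
    (by fun_prop)
    (fun s _ => by
      have h1 : HasDerivAt (fun s : ℝ => 3 * s ^ 2 / R + ε * s) (6 * s / R + ε) s := by
        have := (((hasDerivAt_pow 2 s).const_mul 3).div_const R).add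
          ((hasDerivAt_id s).const_mul ε)
        refine this.congr_deriv ?_
        norm_num; ring
      refine ((h1.pow 2).congr_deriv ?_).hasDerivWithinAt
      simp)
    (fun s hs hfB => by
      have hs0 : 0 < s := ha.trans_le hs.1
      have hbpos : 0 < 3 * s ^ 2 / R + ε * s := by positivity
      have hd : ‖e s‖ = 3 * s ^ 2 / R + ε * s := by
        rw [← hde]
        exact (pow_left_inj₀ Metric.infDist_nonneg hbpos.le two_ne_zero).1 hfB
      have h1 := hinner s hs0.le
      rw [hd] at h1
      set β := 3 * s ^ 2 / R + ε * s with hβ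
      -- On contact `6 s² / R + ε s = β + 3 s² / R`, so the barrier's side is `2 β² + 6 β s² / R`,
      -- against at most `2 β² + 4 β s² / R`.
      have h2 : s * (2 * inner ℝ (e s) τ) < s * (2 * β * (6 * s / R + ε)) := by
        have h3 : s * (2 * β * (6 * s / R + ε)) = 2 * (β ^ 2 + 2 * β * s ^ 2 / R) +
            2 * β * (s ^ 2 / R) := by rw [hβ]; ring
        have h4 : 0 < 2 * β * (s ^ 2 / R) := by positivity
        linarith
      exact lt_of_mul_lt_mul_left h2 hs0.le)
    ⟨hab, le_rfl⟩
  exact (pow_le_pow_iff_left₀ Metric.infDist_nonneg (by positivity) two_ne_zero).1 hfence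

/-- Tangent and normal spaces at nearby points are almost orthogonal. -/
theorem IsEmbeddedSubmanifold.inner_normal_tangent_le (hM : IsEmbeddedSubmanifold M)
    (hc : IsCompact M) (hR : IsProximallySmooth M R) (hR0 : 0 < R) (hx : x ∈ M) (hz : z ∈ M)
    (hn : n ∈ (tangentSpaceAt M z)ᗮ) (hτ : τ ∈ tangentSpaceAt M x) :
    inner ℝ n τ ≤ 8 * ‖n‖ * ‖τ‖ * ‖x - z‖ / R := by
  wlog hτ1 : ‖τ‖ = 1 generalizing τ
  · rcases eq_or_ne τ 0 with rfl | hτ0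
    · simp
    have hpos : 0 < ‖τ‖ := norm_pos_iff.2 hτ0
    have hunit : ‖‖τ‖⁻¹ • τ‖ = 1 := by
      rw [norm_smul, norm_inv, norm_norm, inv_mul_cancel₀ hpos.ne']
    have h := this (Submodule.smul_mem _ ‖τ‖⁻¹ hτ) hunit
    rw [inner_smul_right, hunit, inv_mul_le_iff₀ hpos] at h
    exact h.trans (le_of_eq (by ring))
  rw [hτ1, mul_one]
  rcases eq_or_ne x z with rfl | hxz
  · rw [(Submodule.mem_orthogonal' _ _).1 hn τ hτ]; simp
  set δ := ‖x - z‖ with hδ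
  have hδ0 : 0 < δ := norm_pos_iff.2 (sub_ne_zero.2 hxz)
  -- Step from `x` along `τ` by exactly `δ = ‖x - z‖` and project to `y`. Then `δ • τ = (y - z) - (x
  -- - z) + (x + δ • τ - y)`: two secants at `z` and a quadratic remainder, with constants `9/2 +
  -- 1/2 + 3 = 8`.
  have hP := isNearestPoint_projOnto hc ⟨x, hx⟩ (x + δ • τ)
  set y := projOnto M (x + δ • τ)
  have hyd := hM.infDist_tangent_le hc hR hR0 hx hτ hτ1 hδ0
  rw [hP.infDist_eq] at hyd
  have hyd' : ‖x + δ • τ - y‖ ≤ δ := by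
    have := hP.norm_le hx
    rwa [add_sub_cancel_left, norm_smul, hτ1, mul_one, Real.norm_of_nonneg hδ0.le] at this
  have hyz : ‖y - z‖ ≤ 3 * δ := by
    have h1 : y - z = (x - z) + δ • τ - (x + δ • τ - y) := by abel
    have h2 : ‖δ • τ‖ = δ := by rw [norm_smul, hτ1, mul_one, Real.norm_of_nonneg hδ0.le]
    rw [h1]
    linarith [norm_sub_le ((x - z) + δ • τ) (x + δ • τ - y), norm_add_le (x - z) (δ • τ)]
  have h1 := (abs_le.1 (hM.abs_inner_normal_le hc hR hR0 hz hP.1 hn)).2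
  have h2 := (abs_le.1 (hM.abs_inner_normal_le hc hR hR0 hz hx hn)).1
  have h3 : inner ℝ n (x + δ • τ - y) ≤ ‖n‖ * (3 * δ ^ 2 / R) :=
    (real_inner_le_norm _ _).trans (by gcongr)
  have h4 : δ * inner ℝ n τ = inner ℝ n (y - z) - inner ℝ n (x - z)
      + inner ℝ n (x + δ • τ - y) := by
    rw [← inner_sub_right, ← inner_add_right, ← inner_smul_right]
    congr 1; abel
  have h5 : ‖n‖ * ‖y - z‖ ^ 2 / (2 * R) ≤ ‖n‖ * (3 * δ) ^ 2 / (2 * R) := by gcongr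
  rw [← hδ] at h2
  have h6 : δ * inner ℝ n τ ≤ δ * (8 * ‖n‖ * δ / R) := by
    have : δ * (8 * ‖n‖ * δ / R) = ‖n‖ * (3 * δ) ^ 2 / (2 * R) + ‖n‖ * δ ^ 2 / (2 * R)
        + ‖n‖ * (3 * δ ^ 2 / R) := by field_simp; ring
    linarith
  exact le_of_mul_le_mul_left h6 hδ0

theorem IsNearestPoint.norm_sub_le_two_mul (h : IsNearestPoint M (x + v) z) (hx : x ∈ M) :
    ‖z - x‖ ≤ 2 * ‖v‖ := by
  have h1 := h.norm_le hx
  rw [add_sub_cancel_left] at h1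
  have h2 : z - x = v - (x + v - z) := by abel
  rw [h2]
  linarith [norm_sub_le v (x + v - z)]

/-- The projection is, up to second order, a retraction along the tangent space. -/
theorem IsEmbeddedSubmanifold.norm_sub_starProjection_le (hM : IsEmbeddedSubmanifold M)
    (hc : IsCompact M) (hR : IsProximallySmooth M R) (hR0 : 0 < R) (hx : x ∈ M)
    (hz : IsNearestPoint M (x + v) z) :
    ‖z - x - (tangentSpaceAt M x).starProjection v‖ ≤ 18 * ‖v‖ ^ 2 / R := by
  set T := tangentSpaceAt M x
  set w := x + v - z with hw
  have hwv : ‖w‖ ≤ ‖v‖ := by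
    have h1 := hz.norm_le hx
    rwa [add_sub_cancel_left] at h1
  have hzx := hz.norm_sub_le_two_mul hx
  -- The error is the normal part of the secant `z - x` minus the tangential part of the residual
  -- `w`, which is normal at `z`. Since `‖z - x‖ ≤ 2 ‖v‖`, they contribute `2` and `16`.
  have hdec : z - x - T.starProjection v =
      (z - x - T.starProjection (z - x)) - T.starProjection w := by
    have : T.starProjection w = T.starProjection v - T.starProjection (z - x) := by
      rw [← map_sub]; congr 1; rw [hw]; abel
    rw [this]; abel
  have hnormal : ‖z - x - T.starProjection (z - x)‖ ≤ 2 * ‖v‖ ^ 2 / R := by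
    have hm : z - x - T.starProjection (z - x) ∈ Tᗮ := T.sub_starProjection_mem_orthogonal _
    set m := z - x - T.starProjection (z - x) with hmdef
    have h1 := (abs_le.1 (hM.abs_inner_normal_le hc hR hR0 hx hz.1 hm)).2
    have h2 : inner ℝ m (z - x) = ‖m‖ ^ 2 := by
      have h3 : z - x = m + T.starProjection (z - x) := by rw [hmdef]; abel
      conv_lhs => rw [h3]
      rw [inner_add_right, real_inner_self_eq_norm_sq,
        (Submodule.mem_orthogonal' _ _).1 hm _ (T.starProjection_apply_mem _), add_zero]
    rw [h2] at h1
    rcases (norm_nonneg m).eq_or_lt with h0 | h0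
    · rw [← h0]; positivity
    have h4 : ‖m‖ * ‖m‖ ≤ ‖m‖ * (2 * ‖v‖ ^ 2 / R) := by
      calc ‖m‖ * ‖m‖ = ‖m‖ ^ 2 := by ring
        _ ≤ ‖m‖ * ‖z - x‖ ^ 2 / (2 * R) := h1
        _ ≤ ‖m‖ * (2 * ‖v‖) ^ 2 / (2 * R) := by gcongr
        _ = _ := by field_simp
    exact le_of_mul_le_mul_left h4 h0
  have htangent : ‖T.starProjection w‖ ≤ 16 * ‖v‖ ^ 2 / R := by
    have h1 := hM.inner_normal_tangent_le hc hR hR0 hx hz.1 hz.sub_mem_orthogonal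
      (T.starProjection_apply_mem w)
    rw [← hw] at h1
    set q := T.starProjection w with hq
    have h2 : inner ℝ w q = ‖q‖ ^ 2 := by
      have hm : w - q ∈ Tᗮ := T.sub_starProjection_mem_orthogonal _
      have h3 := (Submodule.mem_orthogonal' _ _).1 hm q (T.starProjection_apply_mem _)
      rw [inner_sub_left, real_inner_self_eq_norm_sq] at h3
      linarith
    rw [h2] at h1
    rcases (norm_nonneg q).eq_or_lt with h0 | h0
    · rw [← h0]; positivity
    have h4 : ‖q‖ * ‖q‖ ≤ ‖q‖ * (16 * ‖v‖ ^ 2 / R) := by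
      calc ‖q‖ * ‖q‖ = ‖q‖ ^ 2 := by ring
        _ ≤ 8 * ‖w‖ * ‖q‖ * ‖x - z‖ / R := h1
        _ ≤ 8 * ‖v‖ * ‖q‖ * (2 * ‖v‖) / R := by
          rw [norm_sub_rev x z]; gcongr
        _ = _ := by ring
    exact le_of_mul_le_mul_left h4 h0
  rw [hdec]
  have h18 : 18 * ‖v‖ ^ 2 / R = 2 * ‖v‖ ^ 2 / R + 16 * ‖v‖ ^ 2 / R := by ring
  rw [h18]
  exact (norm_sub_le _ _).trans (add_le_add hnormal htangent)

end SecondOrder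

/-! ### Second moments of the uniform distribution on the sphere -/

section Sphere

variable {p r : ℕ}

theorem ae_norm_eq_one_uniformUnitSphere : ∀ᵐ u ∂(uniformUnitSphere p r), ‖u‖ = 1 := by
  rw [uniformUnitSphere, ae_map_iff (by fun_prop) (measurableSet_eq_fun (by fun_prop) (by fun_prop))]
  exact Filter.Eventually.of_forall fun u => norm_eq_of_mem_sphere u

open scoped Pointwise in
theorem uniformUnitSphere_apply {s : Set (MatSpace p r)} (hs : MeasurableSet s) :
    uniformUnitSphere p r s = ((volume : Measure (MatSpace p r)).toSphere univ)⁻¹ *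
      (Module.finrank ℝ (MatSpace p r) *
        volume (Ioo (0 : ℝ) 1 • (Metric.sphere (0 : MatSpace p r) 1 ∩ s))) := by
  rw [uniformUnitSphere, Measure.map_apply measurable_subtype_coe hs, Measure.smul_apply,
    Measure.toSphere_apply' _ (measurable_subtype_coe hs), Subtype.image_preimage_coe, smul_eq_mul]

open scoped Pointwise in
-- Surface measure is the volume of the cone over a set, up to a constant, and linear isometries
-- carry cones to cones and preserve volume.
theorem map_linearIsometryEquiv_uniformUnitSphere (L : MatSpace p r ≃ₗᵢ[ℝ] MatSpace p r) :
    (uniformUnitSphere p r).map L = uniformUnitSphere p r := by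
  ext s hs
  rw [Measure.map_apply L.continuous.measurable hs,
    uniformUnitSphere_apply (L.continuous.measurable hs), uniformUnitSphere_apply hs]
  have hset : Ioo (0 : ℝ) 1 • (Metric.sphere (0 : MatSpace p r) 1 ∩ L ⁻¹' s) =
      L ⁻¹' (Ioo (0 : ℝ) 1 • (Metric.sphere (0 : MatSpace p r) 1 ∩ s)) := by
    ext y
    simp only [mem_smul, mem_preimage, mem_inter_iff, mem_sphere_zero_iff_norm]
    constructor
    · rintro ⟨t, ht, u, ⟨hu, hus⟩, rfl⟩
      exact ⟨t, ht, L u, ⟨by rw [L.norm_map, hu], hus⟩, by rw [map_smul]⟩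
    · rintro ⟨t, ht, u, ⟨hu, hus⟩, hy⟩
      refine ⟨t, ht, L.symm u, ⟨by rw [L.symm.norm_map, hu], by simpa using hus⟩, ?_⟩
      rw [← map_smul, hy, L.symm_apply_apply]
  rw [hset, L.measurePreserving.measure_preimage_emb L.toHomeomorph.measurableEmbedding]

theorem integral_comp_linearIsometryEquiv_uniformUnitSphere
    (L : MatSpace p r ≃ₗᵢ[ℝ] MatSpace p r) (g : MatSpace p r → ℝ) :
    ∫ u, g (L u) ∂(uniformUnitSphere p r) = ∫ u, g u ∂(uniformUnitSphere p r) := by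
  conv_rhs => rw [← map_linearIsometryEquiv_uniformUnitSphere L]
  exact (L.toHomeomorph.measurableEmbedding.integral_map g).symm

theorem abs_coord_le_norm (u : MatSpace p r) (i : Fin p × Fin r) : |u i| ≤ ‖u‖ :=
  PiLp.norm_apply_le u i

theorem integrable_coord_mul_coord [IsProbabilityMeasure (uniformUnitSphere p r)]
    (i j : Fin p × Fin r) : Integrable (fun u => u i * u j) (uniformUnitSphere p r) := by
  refine Integrable.of_bound (by fun_prop) 1 ?_
  filter_upwards [ae_norm_eq_one_uniformUnitSphere] with u hu
  rw [norm_mul, Real.norm_eq_abs, Real.norm_eq_abs]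
  have h1 := abs_coord_le_norm u i
  have h2 := abs_coord_le_norm u j
  rw [hu] at h1 h2
  exact mul_le_one₀ h1 (abs_nonneg _) h2

/-- Flipping the sign of the `i`-th coordinate preserves the measure and negates the integrand. -/
theorem integral_coord_mul_coord_of_ne {i j : Fin p × Fin r} (hij : i ≠ j) :
    ∫ u, u i * u j ∂(uniformUnitSphere p r) = 0 := by
  let L : MatSpace p r ≃ₗᵢ[ℝ] MatSpace p r := LinearIsometryEquiv.piLpCongrRight 2
    (fun k => if k = i then LinearIsometryEquiv.neg ℝ else LinearIsometryEquiv.refl ℝ ℝ)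
  have h := integral_comp_linearIsometryEquiv_uniformUnitSphere L (fun u => u i * u j)
  have hL : ∀ u : MatSpace p r, L u i * L u j = -(u i * u j) := fun u => by
    simp [L, hij.symm]
  simp only [hL, integral_neg] at h
  linarith

theorem integral_coord_sq_eq (i j : Fin p × Fin r) :
    ∫ u, u i * u i ∂(uniformUnitSphere p r) = ∫ u, u j * u j ∂(uniformUnitSphere p r) := by
  let L : MatSpace p r ≃ₗᵢ[ℝ] MatSpace p r :=
    LinearIsometryEquiv.piLpCongrLeft 2 ℝ ℝ (Equiv.swap i j)
  have h := integral_comp_linearIsometryEquiv_uniformUnitSphere L (fun u => u j * u j)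
  have hL : ∀ u : MatSpace p r, L u j = u i := fun u => by
    simp [L, LinearIsometryEquiv.piLpCongrLeft_apply]
  simp only [hL] at h
  exact h

/-- The `pr` coordinate second moments are equal by symmetry and sum to `E ‖u‖² = 1`. -/
theorem mul_integral_coord_sq [IsProbabilityMeasure (uniformUnitSphere p r)]
    (i : Fin p × Fin r) : (p * r : ℝ) * ∫ u, u i * u i ∂(uniformUnitSphere p r) = 1 := by
  have h1 : ∫ u : MatSpace p r, ∑ j, u j * u j ∂(uniformUnitSphere p r) = 1 := by
    rw [integral_congr_ae (g := fun _ => (1 : ℝ))]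
    · simp
    · filter_upwards [ae_norm_eq_one_uniformUnitSphere] with u hu
      have := EuclideanSpace.real_norm_sq_eq u
      rw [hu] at this
      simp only [pow_two] at this
      linarith
  rw [integral_finsetSum _ fun j _ => integrable_coord_mul_coord j j] at h1
  rw [Finset.sum_congr rfl fun j _ => integral_coord_sq_eq j i] at h1
  simpa using h1

theorem integral_inner_smul_uniformUnitSphere [IsProbabilityMeasure (uniformUnitSphere p r)]
    (a : MatSpace p r) :
    ∫ u, ((p * r : ℝ) * inner ℝ a u) • u ∂(uniformUnitSphere p r) = a := by
  have hint : Integrable (fun u : MatSpace p r => ((p * r : ℝ) * inner ℝ a u) • u)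
      (uniformUnitSphere p r) := by
    refine Integrable.of_bound (by fun_prop) (p * r * ‖a‖) ?_
    filter_upwards [ae_norm_eq_one_uniformUnitSphere] with u hu
    rw [norm_smul, norm_mul, hu, mul_one, Real.norm_of_nonneg (by positivity)]
    gcongr
    simpa [hu] using norm_inner_le_norm (𝕜 := ℝ) a u
  ext i
  have h1 := (EuclideanSpace.proj i : MatSpace p r →L[ℝ] ℝ).integral_comp_comm
    hint
  simp only [PiLp.proj_apply] at h1
  rw [← h1]
  have h2 : ∀ u : MatSpace p r, (((p * r : ℝ) * inner ℝ a u) • u) i =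
      ∑ k, (p * r : ℝ) * a k * (u k * u i) := fun u => by
    rw [PiLp.smul_apply, smul_eq_mul, PiLp.inner_apply, Finset.mul_sum, Finset.sum_mul]
    refine Finset.sum_congr rfl fun k _ => ?_
    simp only [RCLike.inner_apply, conj_trivial]; ring
  simp only [h2]
  rw [integral_finsetSum _ fun k _ => (integrable_coord_mul_coord k i).const_mul _]
  simp only [integral_const_mul]
  rw [Finset.sum_eq_single i]
  · rw [mul_right_comm, mul_integral_coord_sq, one_mul]
  · intro k _ hk
    rw [integral_coord_mul_coord_of_ne hk, mul_zero]
  · simp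

end Sphere

/-! ### Riemannian gradients and first-order expansion -/

section Gradient

variable {p r : ℕ} {M : Set (MatSpace p r)} {x z : MatSpace p r} {g : MatSpace p r → ℝ}

theorem IsRiemannianGradient.unique {a b : MatSpace p r} (ha : IsRiemannianGradient M g x a)
    (hb : IsRiemannianGradient M g x b) : a = b := by
  have hmem : a - b ∈ (tangentSpaceAt M x)ᗮ := by
    rw [← Submodule.span_singleton_le_iff_mem, Submodule.le_orthogonal_iff_le_orthogonal]
    refine Submodule.span_le.2 ?_
    rintro w ⟨c, hc, rfl⟩
    rw [SetLike.mem_coe, Submodule.mem_orthogonal_singleton_iff_inner_right, inner_sub_left,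
      (ha.2 c hc).unique (hb.2 c hc), sub_self]
  have h := (Submodule.mem_orthogonal' _ _).1 hmem _ (sub_mem ha.1 hb.1)
  exact sub_eq_zero.1 (inner_self_eq_zero.1 h)

/-- Uniqueness of the Riemannian gradient makes the choice in its definition harmless. -/
theorem riemannianGradient_eq_starProjection (hg : DifferentiableAt ℝ g x) :
    riemannianGradient M g x = (tangentSpaceAt M x).starProjection (gradient g x) := by
  have h : IsRiemannianGradient M g x
      ((tangentSpaceAt M x).starProjection (gradient g x)) := by
    refine ⟨Submodule.starProjection_apply_mem _ _, fun c hc => ?_⟩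
    have hgc : HasFDerivAt g (InnerProductSpace.toDual ℝ _ (gradient g x)) (c 0) := by
      rw [hc.1]; exact hg.hasGradientAt.hasFDerivAt
    have h1 := hgc.comp_hasDerivAt (0 : ℝ) hc.hasDerivAt
    rw [InnerProductSpace.toDual_apply_apply] at h1
    have hmem : deriv c 0 ∈ tangentSpaceAt M x := Submodule.subset_span ⟨c, hc, rfl⟩
    have h2 := (Submodule.mem_orthogonal' _ _).1
      ((tangentSpaceAt M x).sub_starProjection_mem_orthogonal (gradient g x)) _ hmem
    rw [inner_sub_left, sub_eq_zero] at h2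
    rw [← h2]
    exact h1
  exact (Classical.epsilon_spec (p := IsRiemannianGradient M g x) ⟨_, h⟩).unique h

/-- Mean value inequality on the segment, which stays inside the convex set. It gives `l` where
integration would give `l / 2`; the order is all that matters. -/
theorem abs_sub_sub_inner_gradient_le {s : Set (MatSpace p r)} (hs : Convex ℝ s) {l : ℝ}
    (hl : 0 ≤ l) (hd : ∀ y ∈ s, DifferentiableAt ℝ g y)
    (hlip : ∀ y ∈ s, ∀ w ∈ s, ‖gradient g y - gradient g w‖ ≤ l * ‖y - w‖)
    (hx : x ∈ s) (hz : z ∈ s) :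
    |g z - g x - inner ℝ (gradient g x) (z - x)| ≤ l * ‖z - x‖ ^ 2 := by
  have hsub : segment ℝ x z ⊆ s := hs.segment_subset hx hz
  have := (convex_segment x z).norm_image_sub_le_of_norm_hasFDerivWithin_le'
    (f := g) (f' := fun y => InnerProductSpace.toDual ℝ _ (gradient g y))
    (φ := InnerProductSpace.toDual ℝ _ (gradient g x)) (C := l * ‖z - x‖)
    (fun q hq => (hd q (hsub hq)).hasGradientAt.hasFDerivAt.hasFDerivWithinAt) (fun q hq => by
      rw [← map_sub, LinearIsometryEquiv.norm_map]
      refine (hlip q (hsub hq) x hx).trans ?_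
      exact mul_le_mul_of_nonneg_left (norm_sub_le_of_mem_segment hq) hl)
    (left_mem_segment ℝ x z) (right_mem_segment ℝ x z)
  rw [InnerProductSpace.toDual_apply_apply, Real.norm_eq_abs] at this
  exact this.trans (le_of_eq (by ring))

end Gradient

/-! ### The difference quotient along the projected step -/

section FiniteDifference

variable {p r : ℕ} {M : Set (MatSpace p r)} {x u : MatSpace p r} {g : MatSpace p r → ℝ}
  {γ χ l μ : ℝ}

/-- The projected step has length at most `2 μ`: the linear term contributes `2 χ`, the quadratic
one `4 l μ ≤ 4 l γ`. -/
theorem abs_projected_difference_le (hc : IsCompact M) (hl : 0 ≤ l)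
    (hd : ∀ y ∈ convexHull ℝ M, DifferentiableAt ℝ g y)
    (hχ : ∀ y ∈ M, ‖gradient g y‖ ≤ χ)
    (hlip : ∀ y ∈ convexHull ℝ M, ∀ w ∈ convexHull ℝ M,
      ‖gradient g y - gradient g w‖ ≤ l * ‖y - w‖)
    (hx : x ∈ M) (hμ : 0 < μ) (hμγ : μ ≤ γ) (hu : ‖u‖ = 1) :
    |(g (projOnto M (x + μ • u)) - g x) / μ| ≤ 2 * χ + 4 * l * γ := by
  have hP := isNearestPoint_projOnto hc ⟨x, hx⟩ (x + μ • u)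
  set z := projOnto M (x + μ • u)
  have hsub := subset_convexHull ℝ M
  have h1 := abs_sub_sub_inner_gradient_le (convex_convexHull ℝ M) hl hd hlip (hsub hx)
    (hsub hP.1)
  have hzx := hP.norm_sub_le_two_mul hx
  rw [norm_smul, hu, mul_one, Real.norm_of_nonneg hμ.le] at hzx
  have hχ0 : 0 ≤ χ := (norm_nonneg _).trans (hχ x hx)
  have h2 : |inner ℝ (gradient g x) (z - x)| ≤ χ * (2 * μ) :=
    (abs_real_inner_le_norm _ _).trans (by gcongr; exact hχ x hx)
  have h3 : l * ‖z - x‖ ^ 2 ≤ l * (2 * μ) ^ 2 := by gcongr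
  have h4 : l * (2 * μ) ^ 2 ≤ 4 * l * γ * μ := by
    have : l * μ * μ ≤ l * μ * γ := by gcongr
    nlinarith
  rw [abs_div, abs_of_pos hμ, div_le_iff₀ hμ]
  have h5 : g z - g x = (g z - g x - inner ℝ (gradient g x) (z - x))
      + inner ℝ (gradient g x) (z - x) := by ring
  rw [h5]
  refine (abs_add_le _ _).trans ?_
  linarith

/-- Here `4 l` is the Taylor remainder over a step of length `2 μ`, and `9 χ / γ` is the projection
error `18 μ² / R` with `R = 2 γ`, paired with the gradient and divided by `μ`. -/
theorem abs_projected_difference_sub_le (hM : IsEmbeddedSubmanifold M) (hc : IsCompact M)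
    (hγ : 0 < γ) (hR : IsProximallySmooth M (2 * γ)) (hl : 0 ≤ l)
    (hd : ∀ y ∈ convexHull ℝ M, DifferentiableAt ℝ g y)
    (hχ : ∀ y ∈ M, ‖gradient g y‖ ≤ χ)
    (hlip : ∀ y ∈ convexHull ℝ M, ∀ w ∈ convexHull ℝ M,
      ‖gradient g y - gradient g w‖ ≤ l * ‖y - w‖)
    (hx : x ∈ M) (hμ : 0 < μ) (hu : ‖u‖ = 1) :
    |(g (projOnto M (x + μ • u)) - g x) / μ - inner ℝ (riemannianGradient M g x) u| ≤
      (4 * l + 9 * χ / γ) * μ := by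
  have hP := isNearestPoint_projOnto hc ⟨x, hx⟩ (x + μ • u)
  set z := projOnto M (x + μ • u)
  have hsub := subset_convexHull ℝ M
  have h1 := abs_sub_sub_inner_gradient_le (convex_convexHull ℝ M) hl hd hlip (hsub hx)
    (hsub hP.1)
  have hnorm : ‖μ • u‖ = μ := by rw [norm_smul, hu, mul_one, Real.norm_of_nonneg hμ.le]
  have hzx := hP.norm_sub_le_two_mul hx
  have h2 := hM.norm_sub_starProjection_le hc hR (by positivity) hx hP
  rw [hnorm] at hzx h2
  have hχ0 : 0 ≤ χ := (norm_nonneg _).trans (hχ x hx)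
  rw [riemannianGradient_eq_starProjection (hd x (hsub hx)),
    Submodule.inner_starProjection_left_eq_right]
  set T := tangentSpaceAt M x
  have h3 : |inner ℝ (gradient g x) (z - x - T.starProjection (μ • u))| ≤
      χ * (18 * μ ^ 2 / (2 * γ)) :=
    (abs_real_inner_le_norm _ _).trans (by gcongr; exact hχ x hx)
  rw [map_smul] at h3
  have h4 : l * ‖z - x‖ ^ 2 ≤ l * (2 * μ) ^ 2 := by gcongr
  have h5 : (g z - g x) / μ - inner ℝ (gradient g x) (T.starProjection u) =
      ((g z - g x - inner ℝ (gradient g x) (z - x)) +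
        inner ℝ (gradient g x) (z - x - μ • T.starProjection u)) / μ := by
    rw [inner_sub_right _ (z - x), inner_smul_right]; field_simp; ring
  rw [h5, abs_div, abs_of_pos hμ, div_le_iff₀ hμ]
  refine (abs_add_le _ _).trans ?_
  have h6 : (4 * l + 9 * χ / γ) * μ * μ = l * (2 * μ) ^ 2 + χ * (18 * μ ^ 2 / (2 * γ)) := by
    field_simp; ring
  linarith

end FiniteDifference

/-- Mean square of the average of pairwise independent bounded vectors. -/
theorem integral_norm_sq_average_le {Ω E : Type*} [MeasurableSpace Ω] {P : Measure Ω}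
    [IsProbabilityMeasure P] [NormedAddCommGroup E] [InnerProductSpace ℝ E] [CompleteSpace E]
    [MeasurableSpace E] [BorelSpace E] {m : ℕ} (hm : 0 < m)
    {V : Fin m → Ω → E} {K b : ℝ} (hV : ∀ j, AEStronglyMeasurable (V j) P)
    (hK : ∀ j, ∀ᵐ w ∂P, ‖V j w‖ ≤ K) (hind : ∀ i j, i ≠ j → IndepFun (V i) (V j) P)
    (hb : ∀ j, ‖∫ w, V j w ∂P‖ ≤ b) :
    Integrable (fun w => ‖(1 / (m : ℝ)) • ∑ j, V j w‖ ^ 2) P ∧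
      ∫ w, ‖(1 / (m : ℝ)) • ∑ j, V j w‖ ^ 2 ∂P ≤ b ^ 2 + K ^ 2 / m := by
  have hm' : (0 : ℝ) < m := by exact_mod_cast hm
  have hb0 : 0 ≤ b := (norm_nonneg _).trans (hb ⟨0, hm⟩)
  have hVint : ∀ j, Integrable (V j) P := fun j => Integrable.of_bound (hV j) K (hK j)
  have hnn : ∀ i j, ∀ᵐ w ∂P, ‖(inner ℝ (V i w) (V j w) : ℝ)‖ ≤ K ^ 2 := fun i j => by
    filter_upwards [hK i, hK j] with w hi hj
    have hK0 : 0 ≤ K := (norm_nonneg _).trans hi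
    calc ‖(inner ℝ (V i w) (V j w) : ℝ)‖ ≤ ‖V i w‖ * ‖V j w‖ := norm_inner_le_norm _ _
      _ ≤ K * K := by gcongr
      _ = K ^ 2 := by ring
  have hint : ∀ i j, Integrable (fun w => (inner ℝ (V i w) (V j w) : ℝ)) P := fun i j =>
    Integrable.of_bound ((hV i).inner (hV j)) (K ^ 2) (hnn i j)
  have hexp : ∀ w, ‖(1 / (m : ℝ)) • ∑ j, V j w‖ ^ 2 =
      (1 / (m : ℝ)) ^ 2 * ∑ i, ∑ j, inner ℝ (V i w) (V j w) := fun w => by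
    rw [norm_smul, mul_pow, Real.norm_eq_abs, sq_abs, ← real_inner_self_eq_norm_sq, sum_inner]
    simp only [inner_sum]
  -- Off the diagonal the expectation factors by independence; on it the almost sure bound is used.
  have hterm : ∀ i j, ∫ w, inner ℝ (V i w) (V j w) ∂P ≤ b ^ 2 + if i = j then K ^ 2 else 0 := by
    intro i j
    split_ifs with hij
    · have h1 := norm_integral_le_of_norm_le_const (hnn i j)
      rw [probReal_univ, mul_one] at h1
      have := (le_abs_self _).trans h1
      nlinarith
    · have h1 : ∫ w, inner ℝ (V i w) (V j w) ∂P =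
          inner ℝ (∫ w, V i w ∂P) (∫ w, V j w ∂P) :=
        (hind i j hij).integral_bilin (hVint i) (hVint j) (innerSL ℝ)
      rw [h1, add_zero]
      calc _ ≤ ‖∫ w, V i w ∂P‖ * ‖∫ w, V j w ∂P‖ := real_inner_le_norm _ _
        _ ≤ b * b := by gcongr <;> exact hb _
        _ = b ^ 2 := by ring
  simp_rw [hexp]
  refine ⟨(integrable_finsetSum _ fun i _ => integrable_finsetSum _ fun j _ => hint i j).const_mul
    _, ?_⟩
  rw [integral_const_mul, integral_finsetSum _ fun i _ => integrable_finsetSum _ fun j _ => hint i j]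
  have hsum : ∑ i : Fin m, ∫ w, ∑ j, inner ℝ (V i w) (V j w) ∂P ≤ m ^ 2 * b ^ 2 + m * K ^ 2 := by
    calc _ = ∑ i, ∑ j, ∫ w, inner ℝ (V i w) (V j w) ∂P :=
          Finset.sum_congr rfl fun i _ => integral_finsetSum _ fun j _ => hint i j
      _ ≤ ∑ i : Fin m, ∑ j : Fin m, (b ^ 2 + if i = j then K ^ 2 else 0) :=
          Finset.sum_le_sum fun i _ => Finset.sum_le_sum fun j _ => hterm i j
      _ = _ := by simp [Finset.sum_add_distrib]; ring
  calc _ ≤ (1 / (m : ℝ)) ^ 2 * (m ^ 2 * b ^ 2 + m * K ^ 2) := by gcongr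
    _ = _ := by field_simp

/-! ### Measurability, bias and mean square error of the estimator -/

section Estimator

variable {p r : ℕ} {M : Set (MatSpace p r)} {x : MatSpace p r} {γ χ l σ μ : ℝ}
  {Ξ : Type*} {F : MatSpace p r → Ξ → ℝ} {f : MatSpace p r → ℝ}

/-- One summand of the estimator. -/
noncomputable def singleSampleEstimator (M : Set (MatSpace p r)) (F : MatSpace p r → Ξ → ℝ) (μ : ℝ)
    (x : MatSpace p r) (q : MatSpace p r × Ξ) : MatSpace p r :=
  ((p * r : ℝ) * ((F (projOnto M (x + μ • q.1)) q.2 - F x q.2) / μ)) • q.1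

theorem zerothOrderEstimator_eq_average {m : ℕ} (u : Fin m → MatSpace p r) (ξ : Fin m → Ξ) :
    zerothOrderEstimator M F μ x u ξ =
      (1 / (m : ℝ)) • ∑ j, singleSampleEstimator M F μ x (u j, ξ j) := by
  simp only [zerothOrderEstimator, singleSampleEstimator, mul_smul, ← Finset.smul_sum]
  module

variable [MeasurableSpace Ξ] {D : Measure Ξ}

/-- The single sample estimator agrees with a measurable function on the unit ball. -/
theorem exists_measurable_singleSampleEstimator (hc : IsCompact M) (hγ : 0 < γ)
    (hR : IsProximallySmooth M (2 * γ)) (hF : Measurable (Function.uncurry F)) (hx : x ∈ M)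
    (hμ : 0 < μ) (hμγ : μ ≤ γ) :
    ∃ Y : MatSpace p r × Ξ → MatSpace p r, Measurable Y ∧
      ∀ q, ‖q.1‖ = 1 → Y q = singleSampleEstimator M F μ x q := by
  classical
  -- `projOnto` is a choice function, controlled only inside the tube. For `‖u‖ ≤ 1` the point `x +
  -- μ • u` is within `γ < 2 γ` of `M`, where the projection is continuous; elsewhere a constant
  -- replaces it.
  let π : MatSpace p r → MatSpace p r :=
    (Metric.closedBall (0 : MatSpace p r) 1).piecewise (fun u => projOnto M (x + μ • u))
      (fun _ => x)
  have hπ : Measurable π := by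
    refine ContinuousOn.measurable_piecewise (fun u hu => ?_) continuousOn_const
      Metric.isClosed_closedBall.measurableSet
    have hu : ‖u‖ ≤ 1 := mem_closedBall_zero_iff.1 hu
    have hdist : Metric.infDist (x + μ • u) M < 2 * γ := by
      refine (Metric.infDist_le_dist_of_mem hx).trans_lt ?_
      rw [dist_eq_norm, add_sub_cancel_left, norm_smul, Real.norm_of_nonneg hμ.le]
      nlinarith
    have h1 := continuousAt_projOnto hc ⟨x, hx⟩ (hR _ hdist)
    exact (ContinuousAt.comp (f := fun u : MatSpace p r => x + μ • u) h1
      (by fun_prop)).continuousWithinAt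
  refine ⟨fun q => ((p * r : ℝ) * ((Function.uncurry F (π q.1, q.2) -
    Function.uncurry F (x, q.2)) / μ)) • q.1, ?_, fun q hq => ?_⟩
  · exact ((((hF.comp ((hπ.comp measurable_fst).prodMk measurable_snd)).sub
      (hF.comp (measurable_const.prodMk measurable_snd))).div_const μ).const_mul _).smul
      measurable_fst
  · have : π q.1 = projOnto M (x + μ • q.1) :=
      piecewise_eq_of_mem _ _ _ (mem_closedBall_zero_iff.2 hq.le)
    simp only [singleSampleEstimator, Function.uncurry_apply_pair, this]

theorem IsSmoothOracle.ae_norm_riemannianGradient_le (h : IsSmoothOracle M D F χ l)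
    (hx : x ∈ M) : ∀ᵐ ξ ∂D, ‖riemannianGradient M (fun y => F y ξ) x‖ ≤ χ := by
  filter_upwards [h] with ξ ⟨hd, hχ, _⟩
  rw [riemannianGradient_eq_starProjection (hd x (subset_convexHull ℝ M hx))]
  exact (Submodule.norm_starProjection_apply_le _ _).trans (hχ x hx)

theorem norm_riemannianGradient_le [IsProbabilityMeasure D] (h : IsSmoothOracle M D F χ l)
    (hu : IsUnbiasedOracle M D F f σ) (hx : x ∈ M) : ‖riemannianGradient M f x‖ ≤ χ := by
  rw [← hu.unbiased_grad x hx]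
  simpa using norm_integral_le_of_norm_le_const (h.ae_norm_riemannianGradient_le hx)

theorem ae_prod_uniformUnitSphere [IsProbabilityMeasure D]
    [IsProbabilityMeasure (uniformUnitSphere p r)] {Q : Ξ → Prop} (hQ : ∀ᵐ ξ ∂D, Q ξ) :
    ∀ᵐ q ∂(uniformUnitSphere p r).prod D, ‖q.1‖ = 1 ∧ Q q.2 :=
  (Measure.quasiMeasurePreserving_fst.ae ae_norm_eq_one_uniformUnitSphere).and
    (Measure.quasiMeasurePreserving_snd.ae hQ)

theorem IsSmoothOracle.ae_norm_singleSampleEstimator_le [IsProbabilityMeasure D]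
    [IsProbabilityMeasure (uniformUnitSphere p r)] (h : IsSmoothOracle M D F χ l)
    (hc : IsCompact M) (hl : 0 ≤ l) (hx : x ∈ M) (hμ : 0 < μ) (hμγ : μ ≤ γ) :
    ∀ᵐ q ∂(uniformUnitSphere p r).prod D,
      ‖singleSampleEstimator M F μ x q‖ ≤ (p * r : ℝ) * (2 * χ + 4 * l * γ) := by
  filter_upwards [ae_prod_uniformUnitSphere h] with q ⟨hq, hd, hχ, hlip⟩
  rw [singleSampleEstimator, norm_smul, hq, mul_one, norm_mul,
    Real.norm_of_nonneg (by positivity), Real.norm_eq_abs]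
  gcongr
  exact abs_projected_difference_le (g := fun y => F y q.2) hc hl hd hχ hlip hx hμ hμγ hq

/-- The bias of the estimator is of first order in the smoothing parameter. -/
theorem norm_integral_sub_riemannianGradient_le [IsProbabilityMeasure D]
    [IsProbabilityMeasure (uniformUnitSphere p r)] (hM : IsEmbeddedSubmanifold M)
    (hc : IsCompact M) (hγ : 0 < γ) (hR : IsProximallySmooth M (2 * γ))
    (h : IsSmoothOracle M D F χ l) (hu : IsUnbiasedOracle M D F f σ) (hl : 0 ≤ l)
    (hx : x ∈ M) (hμ : 0 < μ) {Y : MatSpace p r × Ξ → MatSpace p r}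
    (hY : Integrable Y ((uniformUnitSphere p r).prod D))
    (hYeq : ∀ q, ‖q.1‖ = 1 → Y q = singleSampleEstimator M F μ x q) :
    ‖∫ q, Y q ∂(uniformUnitSphere p r).prod D - riemannianGradient M f x‖ ≤
      (p * r : ℝ) * ((4 * l + 9 * χ / γ) * μ) := by
  set ν := uniformUnitSphere p r
  set G : Ξ → MatSpace p r := fun ξ => riemannianGradient M (fun y => F y ξ) x with hG
  have hGint : Integrable G D := hu.integrable_grad x hx
  set H : MatSpace p r × Ξ → MatSpace p r :=
    fun q => ((p * r : ℝ) * inner ℝ (G q.2) q.1) • q.1 with hH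
  have hHint : Integrable H (ν.prod D) := by
    have hG2 : AEStronglyMeasurable (fun q : MatSpace p r × Ξ => G q.2) (ν.prod D) :=
      hGint.aestronglyMeasurable.comp_snd
    have hfst : AEStronglyMeasurable (fun q : MatSpace p r × Ξ => q.1) (ν.prod D) :=
      measurable_fst.aestronglyMeasurable
    have hHm : AEStronglyMeasurable H (ν.prod D) :=
      ((hG2.inner (𝕜 := ℝ) hfst).const_mul (p * r : ℝ)).smul hfst
    refine Integrable.of_bound hHm (p * r * χ) ?_
    filter_upwards [ae_prod_uniformUnitSphere (h.ae_norm_riemannianGradient_le hx)]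
      with q ⟨hq, hq2⟩
    rw [norm_smul, norm_mul, hq, mul_one, Real.norm_of_nonneg (by positivity)]
    gcongr
    refine (norm_inner_le_norm _ _).trans ?_
    rw [hq, mul_one]; exact hq2
  -- Integrating over `u` first recovers the gradient of `F` for each fixed `ξ`; unbiasedness then
  -- handles `ξ`.
  have hHval : ∫ q, H q ∂ν.prod D = riemannianGradient M f x := by
    rw [integral_prod_symm _ hHint, ← hu.unbiased_grad x hx]
    refine integral_congr_ae (Filter.Eventually.of_forall fun ξ => ?_)
    exact integral_inner_smul_uniformUnitSphere (G ξ)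
  rw [← hHval, ← integral_sub hY hHint]
  have hbound : ∀ᵐ q ∂ν.prod D, ‖Y q - H q‖ ≤ (p * r : ℝ) * ((4 * l + 9 * χ / γ) * μ) := by
    filter_upwards [ae_prod_uniformUnitSphere h] with q ⟨hq, hd, hχ, hlip⟩
    rw [hYeq q hq, singleSampleEstimator, hH]
    simp only
    rw [← sub_smul, ← mul_sub, norm_smul, hq, mul_one, norm_mul,
      Real.norm_of_nonneg (by positivity), Real.norm_eq_abs]
    gcongr
    exact abs_projected_difference_sub_le (g := fun y => F y q.2) hM hc hγ hR hl hd hχ hlip hx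
      hμ hq
  simpa using norm_integral_le_of_norm_le_const hbound

theorem mean_square_error_le [IsProbabilityMeasure D] (hM : IsEmbeddedSubmanifold M)
    (hc : IsCompact M) (hγ : 0 < γ) (hR : IsProximallySmooth M (2 * γ))
    (hF : Measurable (Function.uncurry F)) (h : IsSmoothOracle M D F χ l)
    (hu : IsUnbiasedOracle M D F f σ) (hl : 0 ≤ l) (hχ : 0 ≤ χ) (hpr : 1 ≤ p * r)
    (hx : x ∈ M) (hμ : 0 < μ) (hμγ : μ ≤ γ)
    {m : ℕ} (hm : 0 < m) {Ω : Type*} [MeasurableSpace Ω] {P : Measure Ω} [IsProbabilityMeasure P]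
    {u : Fin m → Ω → MatSpace p r} {ξ : Fin m → Ω → Ξ}
    (hlu : ∀ j, HasLaw (u j) (uniformUnitSphere p r) P) (hlξ : ∀ j, HasLaw (ξ j) D P)
    (huξ : ∀ j, IndepFun (u j) (ξ j) P) (hind : iIndepFun (fun j w => (u j w, ξ j w)) P) :
    Integrable (fun w => ‖zerothOrderEstimator M F μ x (fun j => u j w) (fun j => ξ j w)
        - riemannianGradient M f x‖ ^ 2) P ∧
      ∫ w, ‖zerothOrderEstimator M F μ x (fun j => u j w) (fun j => ξ j w)
        - riemannianGradient M f x‖ ^ 2 ∂P ≤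
        ((p * r : ℝ) * ((4 * l + 9 * χ / γ) * μ)) ^ 2 +
          ((p * r : ℝ) * (3 * χ + 4 * l * γ)) ^ 2 / m := by
  -- The uniform measure has mass one because it is the law of a random variable; `0 < m` provides
  -- one.
  have hprob : IsProbabilityMeasure (uniformUnitSphere p r) :=
    (hlu ⟨0, hm⟩).isProbabilityMeasure_iff.1 inferInstance
  have hm' : (0 : ℝ) < m := by exact_mod_cast hm
  have hlaw : ∀ j, HasLaw (fun w => (u j w, ξ j w)) ((uniformUnitSphere p r).prod D) P :=
    fun j => (huξ j).hasLaw_prod (hlu j) (hlξ j)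
  obtain ⟨Y, hYm, hYeq⟩ := exists_measurable_singleSampleEstimator hc hγ hR hF hx hμ hμγ
  have hYae : ∀ᵐ q ∂(uniformUnitSphere p r).prod D, Y q = singleSampleEstimator M F μ x q := by
    filter_upwards [ae_prod_uniformUnitSphere h] with q hq using hYeq q hq.1
  have hYbound : ∀ᵐ q ∂(uniformUnitSphere p r).prod D,
      ‖Y q‖ ≤ (p * r : ℝ) * (2 * χ + 4 * l * γ) := by
    filter_upwards [hYae, h.ae_norm_singleSampleEstimator_le hc hl hx hμ hμγ] with q h1 h2
    rwa [h1]
  have hYint : Integrable Y ((uniformUnitSphere p r).prod D) :=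
    Integrable.of_bound hYm.aestronglyMeasurable _ hYbound
  set g := riemannianGradient M f x with hg
  have hgχ : ‖g‖ ≤ χ := norm_riemannianGradient_le h hu hx
  have hpr' : (1 : ℝ) ≤ p * r := by exact_mod_cast hpr
  have hpull : ∀ {Q : MatSpace p r × Ξ → Prop},
      (∀ᵐ q ∂(uniformUnitSphere p r).prod D, Q q) → ∀ j, ∀ᵐ w ∂P, Q (u j w, ξ j w) :=
    fun {Q} hQ j => by
      rw [← (hlaw j).map_eq] at hQ
      exact ae_of_ae_map (hlaw j).aemeasurable hQ
  have hmain := integral_norm_sq_average_le (P := P) hm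
    (V := fun j w => Y (u j w, ξ j w) - g) (K := (p * r : ℝ) * (3 * χ + 4 * l * γ))
    (b := (p * r : ℝ) * ((4 * l + 9 * χ / γ) * μ))
    (fun j => ((hYm.comp_aemeasurable (hlaw j).aemeasurable).sub_const g).aestronglyMeasurable)
    -- The extra `χ` bounds the true gradient, and `1 ≤ p * r` lets it go under the factor `p * r`.
    (fun j => by
      filter_upwards [hpull hYbound j] with w hw
      refine (norm_sub_le _ _).trans ?_
      nlinarith)
    (fun i j hij => (hind.indepFun hij).comp (hYm.sub_const g) (hYm.sub_const g))
    (fun j => by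
      have h1 : ∫ w, Y (u j w, ξ j w) ∂P = ∫ q, Y q ∂(uniformUnitSphere p r).prod D :=
        (hlaw j).integral_comp hYm.aestronglyMeasurable
      have h2 : Integrable (fun w => Y (u j w, ξ j w)) P := by
        refine Integrable.of_bound
          (hYm.comp_aemeasurable (hlaw j).aemeasurable).aestronglyMeasurable _ (hpull hYbound j)
      rw [integral_sub h2 (integrable_const g), h1, integral_const, probReal_univ, one_smul]
      exact norm_integral_sub_riemannianGradient_le hM hc hγ hR h hu hl hx hμ hYint hYeq)
  have hae : (fun w => ‖(1 / (m : ℝ)) • ∑ j, (Y (u j w, ξ j w) - g)‖ ^ 2) =ᵐ[P]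
      fun w => ‖zerothOrderEstimator M F μ x (fun j => u j w) (fun j => ξ j w) - g‖ ^ 2 := by
    filter_upwards [ae_all_iff.2 (hpull hYae)] with w hw
    rw [zerothOrderEstimator_eq_average, Finset.sum_sub_distrib, smul_sub]
    simp only [hw]
    congr 3
    rw [Finset.sum_const, Finset.card_univ, Fintype.card_fin, ← Nat.cast_smul_eq_nsmul ℝ,
      smul_smul, one_div, inv_mul_cancel₀ hm'.ne', one_smul]
  exact ⟨hmain.1.congr hae, (integral_congr_ae hae) ▸ hmain.2⟩

end Estimator

/-! ### The choice of constants and the conclusion -/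

theorem lemma3p4 (γ χ l : ℝ) (hγ : 0 < γ) (hχ : 0 < χ) (hl : 0 ≤ l) :
    ∃ (χ₁ : ℕ → ℕ → ℝ) (χ₂ : ℕ → ℕ → ℝ → ℝ),
      (∃ C : ℝ, ∀ p r : ℕ, 0 ≤ χ₁ p r ∧ χ₁ p r ≤ C * ((p : ℝ) ^ 2 * (r : ℝ) ^ 2)) ∧
      (∃ C : ℝ, ∀ (p r : ℕ) (σ : ℝ), 0 ≤ σ →
        0 ≤ χ₂ p r σ ∧ χ₂ p r σ ≤ C * ((p : ℝ) ^ 2 * (r : ℝ) ^ 2 + σ ^ 2)) ∧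
      ∀ (p r : ℕ) (M : Set (MatSpace p r)),
        IsCompact M → IsEmbeddedSubmanifold M → IsProximallySmooth M (2 * γ) →
      ∀ (Ξ : Type*) [MeasurableSpace Ξ] (D : Measure Ξ) [IsProbabilityMeasure D]
        (F : MatSpace p r → Ξ → ℝ) (f : MatSpace p r → ℝ) (σ : ℝ), 0 ≤ σ →
        Measurable (Function.uncurry F) →
        IsUnbiasedOracle M D F f σ → IsSmoothOracle M D F χ l →
      ∀ (m : ℕ), 0 < m →
      ∀ (Ω : Type*) [MeasurableSpace Ω] (P : Measure Ω) [IsProbabilityMeasure P]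
        (u : Fin m → Ω → MatSpace p r) (ξ : Fin m → Ω → Ξ),
        (∀ j, HasLaw (u j) (uniformUnitSphere p r) P) →
        (∀ j, HasLaw (ξ j) D P) →
        (∀ j, IndepFun (u j) (ξ j) P) →
        iIndepFun (fun j w => (u j w, ξ j w)) P →
      ∀ x ∈ M, ∀ μ : ℝ, 0 < μ → μ ≤ γ →
        Integrable (fun w =>
          ‖zerothOrderEstimator M F μ x (fun j => u j w) (fun j => ξ j w)
            - riemannianGradient M f x‖ ^ 2) P ∧
        ∫ w, ‖zerothOrderEstimator M F μ x (fun j => u j w) (fun j => ξ j w)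
            - riemannianGradient M f x‖ ^ 2 ∂P ≤ χ₁ p r * μ ^ 2 + χ₂ p r σ / m := by
  refine ⟨fun p r => (4 * l + 9 * χ / γ) ^ 2 * ((p : ℝ) ^ 2 * (r : ℝ) ^ 2),
    fun p r _ => (3 * χ + 4 * l * γ) ^ 2 * ((p : ℝ) ^ 2 * (r : ℝ) ^ 2),
    ⟨(4 * l + 9 * χ / γ) ^ 2, fun p r => ⟨by positivity, le_rfl⟩⟩,
    ⟨(3 * χ + 4 * l * γ) ^ 2, fun p r σ _ => ⟨by positivity, ?_⟩⟩, ?_⟩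
  · exact mul_le_mul_of_nonneg_left (le_add_of_nonneg_right (sq_nonneg σ)) (sq_nonneg _)
  intro p r M hc hM hR Ξ _ D _ F f σ _ hF hu h m hm Ω _ P _ u ξ hlu hlξ huξ hind x hx μ hμ hμγ
  -- If `p * r = 0` the matrix space is a single point and the error vanishes identically.
  rcases Nat.eq_zero_or_pos (p * r) with h0 | hpr
  · have : IsEmpty (Fin p × Fin r) := by
      rw [← Fintype.card_eq_zero_iff]; simpa using h0
    have hz : ∀ y : MatSpace p r, ‖y‖ ^ 2 = 0 := fun y => by
      rw [Subsingleton.elim y 0]; simp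
    simp only [hz]
    refine ⟨integrable_const _, ?_⟩
    rw [integral_zero]
    positivity
  · obtain ⟨h1, h2⟩ := mean_square_error_le hM hc hγ hR hF h hu hl hχ.le hpr hx hμ hμγ hm hlu
      hlξ huξ hind
    exact ⟨h1, h2.trans (le_of_eq (by ring))⟩
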